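/- **Notation.** For a set $D$ of ordinals let $\mathrm{acc}^+(D)=\{\alpha<\sup D\mid \sup(D\cap\alpha)=\alpha>0\}$, $\mathrm{acc}(D)=D\cap\mathrm{acc}^+(D)$, $\mathrm{nacc}(D)=D\setminus\mathrm{acc}^+(D)$, and, for an ordinal $\sigma$, $\mathrm{suc}_\sigma(D)=\{\delta\in D\mid \mathrm{otp}(D\cap\delta)=j+1\text{ for some }j<\sigma\}$. For cardinals $\kappa,\eta$, $E^{\kappa}_{\eta}$ is the set of ordinals below $\kappa$ of cofinality $\eta$. Products of ordinals are ordinal products. For a regular uncountable cardinal $\kappa$: * $\diamondsuit(S)$, for $S\subseteq\kappa$, asserts that there is $\langle Z_\beta\mid\beta\in S\rangle$ with $Z_\beta\subseteq\beta$ such that for every $Z\subseteq\kappa$ the set $\{\beta\in S\mid Z\cap\beta=Z_\beta\}$ is stationary in $\kappa$. * $D\sqsubseteq C$, for $C,D\in[\kappa]^{<\kappa}$, means that $D=C\cap\beta$ for some $\beta<\kappa$; and $D\mathrel{\mathcal E_\chi}C$, for $C,D\subseteq\kappa$, means that $\mathrm{otp}(D)\le\chi$ and $\mathrm{otp}(C)\le\chi$.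 * $P^-(\kappa,\mu,\mathcal R,\theta,\mathcal S,\nu,\sigma,\mathcal E)$ asserts that there is a sequence $\langle\mathcal C_\alpha\mid\alpha<\kappa\rangle$ (a *witness*) such that: for every limit $\alpha<\kappa$, $\mathcal C_\alpha$ is a collection of club subsets of $\alpha$; for every $\alpha<\kappa$, $0<|\mathcal C_\alpha|<\mu$ and $C\mathrel{\mathcal E}D$ for all $C,D\in\mathcal C_\alpha$; for all $\alpha<\kappa$, $C\in\mathcal C_\alpha$ and $\bar\alpha\in\mathrm{acc}(C)$ there is $D\in\mathcal C_{\bar\alpha}$ with $D\mathrel{\mathcal R}C$; and for every sequence $\langle A_i\mid i<\theta\rangle$ of cofinal subsets of $\kappa$ and every $S\in\mathcal S$ there are stationarily many $\alpha\in S$ for which $|\mathcal C_\alpha|<\nu$ and $\sup\{\beta\in C\mid\mathrm{suc}_\sigma(C\setminus\beta)\subseteq A_i\}=\alpha$ for all $C\in\mathcal C_\alpha$ and $i<\min\{\alpha,\theta\}$. * $P(\kappa,\mu,\mathcal R,\theta,\mathcal S,\nu,\sigma,\mathcal E)$ asserts that both $P^-(\kappa,\mu,\mathcal R,\theta,\mathcal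 S,\nu,\sigma,\mathcal E)$ and $\diamondsuit(\kappa)$ hold. For an infinite cardinal $\lambda$, $\mathrm{SD}_\lambda$ asserts that there is a sequence $\langle(D_\alpha,X_\alpha)\mid\alpha<\lambda^+\rangle$ such that: for every limit $\alpha<\lambda^+$, $D_\alpha$ is a club in $\alpha$ of order type $\le\omega\cdot\lambda$ and $X_\alpha\subseteq\alpha$; if $\bar\alpha\in\mathrm{acc}(D_\alpha)$, then $D_\alpha\cap\bar\alpha=D_{\bar\alpha}$ and $X_\alpha\cap\bar\alpha=X_{\bar\alpha}$; and for every $X\subseteq\lambda^+$ and every club $E\subseteq\lambda^+$ there is a limit $\alpha<\lambda^+$ with $\mathrm{otp}(\mathrm{acc}(D_\alpha))=\lambda$, $X\cap\alpha=X_\alpha$ and $\mathrm{acc}(D_\alpha)\subseteq E$. **Theorem.** Assume that one of the following holds: * $\lambda=\aleph_0$, $S\subseteq\omega_1$ and $\diamondsuit(S)$ holds; or * $\lambda$ is an uncountable cardinal, $S=E^{\lambda^+}_{\mathrm{cf}(\lambda)}$ and $\mathrm{SD}_\lambda$ holds. Let $\chi:=\omega\cdot\lambda$ and let $\sigma<\chi$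 be any ordinal. Then $P(\lambda^+,2,\sqsubseteq,\lambda^+,\{S\},2,\sigma,\mathcal E_\chi)$ holds. Moreover, there exist a sequence $\langle C_\alpha\mid\alpha<\lambda^+\rangle$ such that $\langle\{C_\alpha\}\mid\alpha<\lambda^+\rangle$ witnesses $P^-(\lambda^+,2,\sqsubseteq,\lambda^+,\{S\},2,\sigma,\mathcal E_\chi)$, and a function $h:\lambda^+\to\lambda^+$, satisfying the following: * if $\alpha<\lambda^+$ is a limit ordinal, then $C_\alpha$ is a club subset of $\alpha\setminus\{0\}$ of order type $\le\chi$; * if $\bar\alpha\in\mathrm{acc}(C_\alpha)$, then $C_{\bar\alpha}=C_\alpha\cap\bar\alpha$ and $h(\bar\alpha)=h(\alpha)$; * for every sequence $\langle A_\delta\mid\delta<\lambda^+\rangle$ of cofinal subsets of $\lambda^+$, every club $D\subseteq\lambda^+$ and every $\varsigma<\lambda^+$, there exists $\alpha\in S$ such that 1. $h(\alpha)=\varsigma$; 2. $\mathrm{nacc}(C_\alpha)\subseteq\bigcup_{\delta<\alpha}A_\delta$; 3. $\mathrm{otp}(\{\beta\in\mathrm{acc}(C_\alpha)\mid\mathrm{suc}_\sigma(C_\alpha\setminus\beta)\subseteq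 A_\delta\})=\lambda$ for every $\delta<\alpha$; 4. for all $\beta<\gamma$ in $C_\alpha$ there is $\eta\in D$ with $\beta<\eta<\gamma$. -/

import Mathlib

universe u

open scoped Ordinal Cardinal
open Set

namespace ProxyPrinciple

noncomputable section

/-! ### Sets of ordinals

An ordinal `δ` is identified with the set `Set.Iio δ` of its predecessors, and a cardinal `κ` with
its initial ordinal `κ.ord`. Sets of ordinals are of type `Set Ordinal.{u}`. -/

/-- The trace of a set of ordinals on `δ`, as a subset of the well-order `δ`. -/
def trace (D : Set Ordinal.{u}) (δ : Ordinal.{u}) : Set (Iio δ) := {x | (x : Ordinal.{u}) ∈ D}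

/-- `A` is a cofinal subset of `δ`. -/
def IsCofinalIn (A : Set Ordinal.{u}) (δ : Ordinal.{u}) : Prop :=
  A ⊆ Iio δ ∧ IsCofinal (trace A δ)

/-- `C` is a club (closed and cofinal) subset of `δ`. -/
def IsClubIn (C : Set Ordinal.{u}) (δ : Ordinal.{u}) : Prop :=
  C ⊆ Iio δ ∧ IsClub (trace C δ)

/-- `S` is a stationary subset of `δ`: it meets every club subset of `δ`. -/
def IsStationaryIn (S : Set Ordinal.{u}) (δ : Ordinal.{u}) : Prop :=
  S ⊆ Iio δ ∧ IsStationary (trace S δ)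

/-- The order type of a set of ordinals (a priori in the next universe; it is compared with
ordinals of the universe `u` by means of `Ordinal.lift`). -/
def otp (D : Set Ordinal.{u}) : Ordinal.{u + 1} := Ordinal.type ((· < ·) : D → D → Prop)

/-- `acc⁺(D) = {α < sup D ∣ sup (D ∩ α) = α > 0}`. -/
def accPlus (D : Set Ordinal.{u}) : Set Ordinal.{u} :=
  {α | α < sSup D ∧ sSup (D ∩ Iio α) = α ∧ 0 < α}

/-- The accumulation points of `D` that belong to `D`. -/
def acc (D : Set Ordinal.{u}) : Set Ordinal.{u} := D ∩ accPlus D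

/-- The elements of `D` that are not accumulation points of `D`. -/
def nacc (D : Set Ordinal.{u}) : Set Ordinal.{u} := D \ accPlus D

/-- `suc_σ(D) = {δ ∈ D ∣ otp(D ∩ δ) = j + 1 for some j < σ}`. -/
def suc (σ : Ordinal.{u}) (D : Set Ordinal.{u}) : Set Ordinal.{u} :=
  {δ | δ ∈ D ∧ ∃ j < σ, otp (D ∩ Iio δ) = Ordinal.lift.{u + 1} (j + 1)}

/-- `E^κ_η`: the set of all ordinals below `κ` of cofinality `η`. -/
def cofSet (κ η : Cardinal.{u}) : Set Ordinal.{u} := {α | α < κ.ord ∧ α.cof = η}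

/-! ### Diamonds -/

/-- Jensen's principle `◇(S)` for a subset `S` of `κ`. -/
def Diamond (κ : Cardinal.{u}) (S : Set Ordinal.{u}) : Prop :=
  ∃ Z : Ordinal.{u} → Set Ordinal.{u},
    (∀ β ∈ S, Z β ⊆ Iio β) ∧
    ∀ X ⊆ Iio κ.ord, IsStationaryIn {β | β ∈ S ∧ X ∩ Iio β = Z β} κ.ord

/-- The principle `SD_lam`, for an infinite cardinal `lam` (square and diamond, simultaneously). -/
def SquareDiamond (lam : Cardinal.{u}) : Prop :=
  ∃ D X : Ordinal.{u} → Set Ordinal.{u},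
    (∀ α < (Order.succ lam).ord, Order.IsSuccLimit α →
      IsClubIn (D α) α ∧ otp (D α) ≤ Ordinal.lift.{u + 1} (ω * lam.ord) ∧ X α ⊆ Iio α) ∧
    (∀ α < (Order.succ lam).ord, ∀ α' ∈ acc (D α),
      D α ∩ Iio α' = D α' ∧ X α ∩ Iio α' = X α') ∧
    ∀ Y ⊆ Iio (Order.succ lam).ord, ∀ E, IsClubIn E (Order.succ lam).ord →
      ∃ α < (Order.succ lam).ord, Order.IsSuccLimit α ∧
        otp (acc (D α)) = Ordinal.lift.{u + 1} lam.ord ∧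
        Y ∩ Iio α = X α ∧ acc (D α) ⊆ E

/-! ### The proxy principle -/

/-- Membership in `[κ]^{<κ}`. -/
def IsSmallIn (κ : Cardinal.{u}) (D : Set Ordinal.{u}) : Prop :=
  D ⊆ Iio κ.ord ∧ #D < Cardinal.lift.{u + 1} κ

/-- The relation `D ⊑ C` over `[κ]^{<κ}`: `C` end-extends `D`. -/
def EndExt (κ : Cardinal.{u}) (D C : Set Ordinal.{u}) : Prop :=
  IsSmallIn κ D ∧ IsSmallIn κ C ∧ ∃ β < κ.ord, D = C ∩ Iio β

/-- The equivalence relation `𝓔_χ` over a subset of `𝒫(κ)`: both sets have order type at most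
`χ`. -/
def OtpLE (κ : Cardinal.{u}) (χ : Ordinal.{u}) (D C : Set Ordinal.{u}) : Prop :=
  (D ⊆ Iio κ.ord ∧ otp D ≤ Ordinal.lift.{u + 1} χ) ∧
  (C ⊆ Iio κ.ord ∧ otp C ≤ Ordinal.lift.{u + 1} χ)

/-- The sequence `⟨𝒞_α ∣ α < κ⟩` witnesses `P⁻(κ, μ, R, θ, 𝒮, ν, σ, E)`. Here `κ` is a regular
uncountable cardinal, `2 ≤ ν ≤ μ ≤ κ` and `1 ≤ θ ≤ κ` are cardinals, `R` is a binary relation over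
`[κ]^{<κ}`, `𝒮` is a nonempty collection of stationary subsets of `κ`, `σ ≤ κ` is an ordinal and
`E` is an equivalence relation over a subset of `𝒫(κ)`. -/
structure IsWitness (κ μ : Cardinal.{u}) (R : Set Ordinal.{u} → Set Ordinal.{u} → Prop)
    (θ : Cardinal.{u}) (𝒮 : Set (Set Ordinal.{u})) (ν : Cardinal.{u}) (σ : Ordinal.{u})
    (E : Set Ordinal.{u} → Set Ordinal.{u} → Prop)
    (𝒞 : Ordinal.{u} → Set (Set Ordinal.{u})) : Prop where
  club : ∀ α < κ.ord, Order.IsSuccLimit α → ∀ C ∈ 𝒞 α, IsClubIn C α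
  width : ∀ α < κ.ord, 0 < #(𝒞 α) ∧ #(𝒞 α) < Cardinal.lift.{u + 1} μ
  equiv : ∀ α < κ.ord, ∀ C ∈ 𝒞 α, ∀ D ∈ 𝒞 α, E C D
  coherence : ∀ α < κ.ord, ∀ C ∈ 𝒞 α, ∀ α' ∈ acc C, ∃ D ∈ 𝒞 α', R D C
  guessing : ∀ A : Ordinal.{u} → Set Ordinal.{u}, (∀ i < θ.ord, IsCofinalIn (A i) κ.ord) →
    ∀ S ∈ 𝒮, IsStationaryIn
      {α | α ∈ S ∧ #(𝒞 α) < Cardinal.lift.{u + 1} ν ∧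
        ∀ C ∈ 𝒞 α, ∀ i < min α θ.ord, sSup {β | β ∈ C ∧ suc σ (C \ Iio β) ⊆ A i} = α} κ.ord

/-- The principle `P⁻(κ, μ, R, θ, 𝒮, ν, σ, E)`. -/
def ProxyMinus (κ μ : Cardinal.{u}) (R : Set Ordinal.{u} → Set Ordinal.{u} → Prop)
    (θ : Cardinal.{u}) (𝒮 : Set (Set Ordinal.{u})) (ν : Cardinal.{u}) (σ : Ordinal.{u})
    (E : Set Ordinal.{u} → Set Ordinal.{u} → Prop) : Prop :=
  ∃ 𝒞 : Ordinal.{u} → Set (Set Ordinal.{u}), IsWitness κ μ R θ 𝒮 ν σ E 𝒞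

/-- The principle `P(κ, μ, R, θ, 𝒮, ν, σ, E)`: both `P⁻(κ, μ, R, θ, 𝒮, ν, σ, E)` and `◇(κ)`
hold. -/
def Proxy (κ μ : Cardinal.{u}) (R : Set Ordinal.{u} → Set Ordinal.{u} → Prop)
    (θ : Cardinal.{u}) (𝒮 : Set (Set Ordinal.{u})) (ν : Cardinal.{u}) (σ : Ordinal.{u})
    (E : Set Ordinal.{u} → Set Ordinal.{u} → Prop) : Prop :=
  ProxyMinus κ μ R θ 𝒮 ν σ E ∧ Diamond κ (Iio κ.ord)

end

end ProxyPrinciple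

open ProxyPrinciple

namespace ProxyPrinciple

/-! Guessing is separated from the building of clubs by the notion of a `Ladder`: coherent closed
sets `T α` of limit ordinals together with guesses `𝔅 ε i`. For any sequence `B` and function `f`,
some `α ∈ S` has `T α` cofinal of order type `λ`, and every `ε ∈ T α` is closed under `f` and
guesses `B i ∩ ε` correctly for all `i < ε` at once.

From `SD_λ`, take `T α = acc (D α)`: coherence hands the guess at `α` down to every accumulation
point (`SquareDiamond.exists_ladder`). From `◇(S)` on `ω₁`, each ordinal also guesses its
predecessor in a tree of height `ω`, and `T α` is a cofinal branch below `α`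
(`Diamond.exists_ladder`).

Given a ladder, each `ε` with `T ε` bounded in `ε` receives a thread `F ε` of type `ω`, cofinal in
`ε` and above `sup (T ε)`. The club `C_α` is `T α` together with the threads in its gaps. Thus `acc
C_α = T α`, coherence is inherited, and the order type is at most `ω · λ`. The thread at `ε` is
drawn from the guess of `A_δ`, for a label `δ < ε`, with gaps witnessed by the guess of `D`; `h α`
is read off the guess of `{ς}` at `min (T α)`.

For the labels, fix `τ < λ` with `σ ≤ ω · τ` and cut the indices along the ladder into blocks of
length `τ + 1`. Bookkeeping assigns to block `b` a pair `(m, ξ)`, naming the `ξ`-th element of the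
`m`-th ladder point, so labels depend on `T ε` only. Each `δ < α` is the label of `λ` many blocks.
If `β` starts such a block, the first `σ` successor points of `C_α` after `β` lie in threads of that
block, hence in `A_δ` (`Ladder.le_mk_captured`). -/

/-! ### Limit points, clubs and stationary sets. -/

/-- `β` is a limit point of the set of ordinals `C`. -/
def IsLimPt (C : Set Ordinal.{u}) (β : Ordinal.{u}) : Prop :=
  0 < β ∧ ∀ x < β, ∃ y ∈ C, x < y ∧ y < β

theorem IsLimPt.isSuccLimit {C : Set Ordinal.{u}} {β : Ordinal.{u}} (h : IsLimPt C β) :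
    Order.IsSuccLimit β := by
  rw [Ordinal.isSuccLimit_iff, Order.isSuccPrelimit_iff_succ_lt]
  refine ⟨h.1.ne', fun a ha => ?_⟩
  obtain ⟨y, -, h1, h2⟩ := h.2 a ha
  exact (Order.succ_le_of_lt h1).trans_lt h2

theorem IsLimPt.mono {C D : Set Ordinal.{u}} {β : Ordinal.{u}} (h : IsLimPt C β)
    (hCD : ∀ x ∈ C, x < β → x ∈ D) : IsLimPt D β :=
  ⟨h.1, fun x hx => let ⟨y, hy, h1, h2⟩ := h.2 x hx; ⟨y, hCD y hy h2, h1, h2⟩⟩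

theorem isLimPt_iff_sSup {C : Set Ordinal.{u}} {β : Ordinal.{u}} :
    IsLimPt C β ↔ sSup (C ∩ Iio β) = β ∧ 0 < β := by
  have hb : BddAbove (C ∩ Iio β) := ⟨β, fun x hx => hx.2.le⟩
  constructor
  · rintro h
    refine ⟨le_antisymm (csSup_le' fun x hx => hx.2.le) ?_, h.1⟩
    by_contra! hlt
    obtain ⟨y, hy, h1, h2⟩ := h.2 _ hlt
    exact absurd (le_csSup hb ⟨hy, h2⟩) (not_le.2 h1)
  · rintro ⟨h1, h2⟩
    refine ⟨h2, fun x hx => ?_⟩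
    rw [← h1] at hx
    obtain ⟨y, hy, hxy⟩ := exists_lt_of_lt_csSup' hx
    exact ⟨y, hy.1, hxy, hy.2⟩

theorem IsLimPt.sSup_eq {C : Set Ordinal.{u}} {α : Ordinal.{u}} (h : IsLimPt C α)
    (hC : C ⊆ Iio α) : sSup C = α := by
  have := (isLimPt_iff_sSup.1 h).1
  rwa [inter_eq_left.2 hC] at this

theorem mem_accPlus_iff {C : Set Ordinal.{u}} {α β : Ordinal.{u}} (h : IsLimPt C α)
    (hC : C ⊆ Iio α) : β ∈ accPlus C ↔ β < α ∧ IsLimPt C β := by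
  rw [accPlus, mem_ofPred_eq, h.sSup_eq hC, isLimPt_iff_sSup]

theorem mem_acc_iff {C : Set Ordinal.{u}} {α β : Ordinal.{u}} (h : IsLimPt C α)
    (hC : C ⊆ Iio α) : β ∈ acc C ↔ β ∈ C ∧ IsLimPt C β := by
  rw [acc, mem_inter_iff, mem_accPlus_iff h hC]
  exact ⟨fun h => ⟨h.1, h.2.2⟩, fun h => ⟨h.1, hC h.1, h.2⟩⟩

theorem mem_nacc_iff {C : Set Ordinal.{u}} {α β : Ordinal.{u}} (h : IsLimPt C α)
    (hC : C ⊆ Iio α) : β ∈ nacc C ↔ β ∈ C ∧ ¬ IsLimPt C β := by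
  rw [nacc, mem_sdiff, mem_accPlus_iff h hC]
  exact ⟨fun h => ⟨h.1, fun h' => h.2 ⟨hC h.1, h'⟩⟩, fun h => ⟨h.1, fun h' => h.2 h'.2⟩⟩

theorem acc_empty : acc (∅ : Set Ordinal.{u}) = ∅ := by simp [acc]

theorem isCofinalIn_iff {A : Set Ordinal.{u}} {δ : Ordinal.{u}} (hδ : Order.IsSuccLimit δ) :
    IsCofinalIn A δ ↔ A ⊆ Iio δ ∧ IsLimPt A δ := by
  refine and_congr_right fun hA => ⟨fun h => ⟨?_, fun x hx => ?_⟩, fun h x => ?_⟩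
  · exact zero_lt_one.trans (Ordinal.one_lt_of_isSuccLimit hδ)
  · obtain ⟨y, hy, hxy⟩ := h ⟨Order.succ x, hδ.succ_lt hx⟩
    exact ⟨y, hy, Order.succ_le_iff.1 hxy, y.2⟩
  · obtain ⟨y, hy, h1, h2⟩ := h.2 x x.2
    exact ⟨⟨y, h2⟩, hy, h1.le⟩

/-- A least upper bound of a nonempty subset of `C` either belongs to that subset or is a limit
point of `C`, so closure under suprema is closure under limit points. -/
theorem isClubIn_iff {C : Set Ordinal.{u}} {δ : Ordinal.{u}} (hδ : Order.IsSuccLimit δ) :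
    IsClubIn C δ ↔ C ⊆ Iio δ ∧ IsLimPt C δ ∧ ∀ β < δ, IsLimPt C β → β ∈ C := by
  rw [IsClubIn, isClub_iff]
  constructor
  · rintro ⟨h1, h2, h3⟩
    refine ⟨h1, ((isCofinalIn_iff hδ).1 ⟨h1, h3⟩).2, fun β hβ hl => ?_⟩
    have : (⟨β, hβ⟩ : Iio δ) ∈ trace C δ := by
      refine h2 (d := {x | (x : Ordinal.{u}) ∈ C ∧ (x : Ordinal.{u}) < β}) (fun x hx => hx.1)
        ?_ (.of_linearOrder _) ⟨fun x hx => hx.2.le, fun x hx => ?_⟩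
      · obtain ⟨y, hy, -, hy'⟩ := hl.2 0 hl.1
        exact ⟨⟨y, h1 hy⟩, hy, hy'⟩
      · by_contra! hlt
        obtain ⟨y, hy, h1, h2⟩ := hl.2 x hlt
        exact absurd (hx (show (⟨y, h2.trans hβ⟩ : Iio δ) ∈ _ from ⟨hy, h2⟩)) (not_le.2 h1)
    exact this
  · rintro ⟨h1, h2, h3⟩
    refine ⟨h1, fun d hd hne _ a ha => ?_, ((isCofinalIn_iff hδ).2 ⟨h1, h2⟩).2⟩
    by_cases had : a ∈ d
    · exact hd had
    · have hlt : ∀ x ∈ d, x < a := fun x hx => (ha.1 hx).lt_of_ne fun h => had (h ▸ hx)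
      refine h3 a a.2 ⟨?_, fun x hx => ?_⟩
      · obtain ⟨x, hx⟩ := hne
        exact zero_le.trans_lt (show (x : Ordinal.{u}) < a from hlt x hx)
      · have : ¬ (⟨x, hx.trans a.2⟩ : Iio δ) ∈ upperBounds d := fun h =>
          absurd (ha.2 h) (not_le.2 hx)
        simp only [upperBounds, mem_ofPred_eq, not_forall, not_le] at this
        obtain ⟨y, hy, hxy⟩ := this
        exact ⟨y, hd hy, hxy, hlt y hy⟩

theorem IsStationaryIn.exists_mem {S C : Set Ordinal.{u}} {δ : Ordinal.{u}}
    (hS : IsStationaryIn S δ) (hC : IsClubIn C δ) : ∃ α ∈ S, α ∈ C := by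
  obtain ⟨x, h1, h2⟩ := hS.2 hC.2
  exact ⟨x, h1, h2⟩

theorem isStationaryIn_of_forall {S : Set Ordinal.{u}} {δ : Ordinal.{u}} (hS : S ⊆ Iio δ)
    (h : ∀ C, IsClubIn C δ → ∃ α ∈ S, α ∈ C) : IsStationaryIn S δ := by
  refine ⟨hS, fun t ht => ?_⟩
  have htr : trace (Subtype.val '' t) δ = t := by
    ext x
    exact ⟨fun ⟨y, hy, h⟩ => Subtype.ext h ▸ hy, fun h => ⟨x, h, rfl⟩⟩
  obtain ⟨α, h1, ⟨x, hx, rfl⟩⟩ := h (Subtype.val '' t)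
    ⟨by rintro _ ⟨x, -, rfl⟩; exact x.2, by rwa [htr]⟩
  exact ⟨x, h1, hx⟩

/-! ### Closure points of functions and infinite sets of ordinals. -/

/-- The limit ordinals below `δ` that are closed under the binary function `f`. -/
def closurePts (δ : Ordinal.{u}) (f : Ordinal.{u} → Ordinal.{u} → Ordinal.{u}) :
    Set Ordinal.{u} :=
  {ε | ε < δ ∧ Order.IsSuccLimit ε ∧ ∀ x < ε, ∀ y < ε, f x y < ε}

theorem exists_closure_bound {κ : Cardinal.{u}} (hκ : κ.IsRegular)
    {f : Ordinal.{u} → Ordinal.{u} → Ordinal.{u}}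
    (hf : ∀ x < κ.ord, ∀ y < κ.ord, f x y < κ.ord) {z : Ordinal.{u}} (hz : z < κ.ord) :
    ∃ w < κ.ord, z < w ∧ ∀ x ≤ z, ∀ y ≤ z, f x y < w := by
  have hlim := Cardinal.isSuccLimit_ord hκ.aleph0_le
  let g : Iio (Order.succ z) × Iio (Order.succ z) → Ordinal.{u} := fun p => f p.1 p.2
  have hsz := hlim.succ_lt hz
  have hlt : ⨆ p, g p + 1 < κ.ord := by
    apply Ordinal.lift_iSup_add_one_lt_of_lt_cof
    · rw [← Ordinal.lift_cof, hκ.cof_ord, Cardinal.mk_prod, Cardinal.mk_Iio_ordinal]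
      have h1 : (Order.succ z).card < κ := Cardinal.lt_ord.1 hsz
      have := Cardinal.mul_lt_of_lt hκ.aleph0_le h1 h1
      rw [← Cardinal.lift_lt.{u, u + 1}] at this
      simpa using this
    · rintro ⟨x, y⟩
      exact hf _ (x.2.trans hsz) _ (y.2.trans hsz)
  refine ⟨max (Order.succ z) (⨆ p, g p + 1), max_lt hsz hlt,
    lt_max_of_lt_left (Order.lt_succ z), fun x hx y hy => lt_max_of_lt_right ?_⟩
  exact Ordinal.lt_iSup_add_one (f := g) (⟨x, Order.lt_succ_of_le hx⟩, ⟨y, Order.lt_succ_of_le hy⟩)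

/-- Iterating the bound of `exists_closure_bound` `ω` times stays below `κ` because `κ` is regular
and uncountable, and the supremum is closed under `f`. -/
theorem isClubIn_closurePts {κ : Cardinal.{u}} (hκ : κ.IsRegular) (hκ' : ℵ₀ < κ)
    {f : Ordinal.{u} → Ordinal.{u} → Ordinal.{u}}
    (hf : ∀ x < κ.ord, ∀ y < κ.ord, f x y < κ.ord) : IsClubIn (closurePts κ.ord f) κ.ord := by
  have hlim := Cardinal.isSuccLimit_ord hκ.aleph0_le
  rw [isClubIn_iff hlim]
  refine ⟨fun x hx => hx.1, ⟨hκ.ord_pos, fun a ha => ?_⟩, fun β hβ hl => ⟨hβ, hl.isSuccLimit, ?_⟩⟩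
  · have : ∀ z, ∃ w, z < κ.ord → w < κ.ord ∧ z < w ∧ ∀ x ≤ z, ∀ y ≤ z, f x y < w := by
      intro z
      by_cases hz : z < κ.ord
      · obtain ⟨w, hw⟩ := exists_closure_bound hκ hf hz
        exact ⟨w, fun _ => hw⟩
      · exact ⟨0, fun h => absurd h hz⟩
    choose g hg using this
    have hlt : Ordinal.nfp g a < κ.ord :=
      Cardinal.nfp_lt_ord_of_isRegular hκ hκ'.ne' (fun i hi => (hg i hi).1) ha
    have hit : ∀ n, g^[n] a < κ.ord := fun n => (Ordinal.iterate_le_nfp g a n).trans_lt hlt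
    have hstep : ∀ n, g^[n] a < g^[n + 1] a := fun n => by
      rw [Function.iterate_succ_apply']
      exact (hg _ (hit n)).2.1
    have hmono : StrictMono fun n => g^[n] a := strictMono_nat_of_lt_succ hstep
    have hlt' : ∀ n, g^[n] a < Ordinal.nfp g a := fun n =>
      (hstep n).trans_le (Ordinal.iterate_le_nfp g a _)
    refine ⟨Ordinal.nfp g a, ⟨hlt, ?_, fun x hx y hy => ?_⟩, hlt' 0, hlt⟩
    · rw [Ordinal.isSuccLimit_iff, Order.isSuccPrelimit_iff_succ_lt]
      refine ⟨(zero_le.trans_lt (hlt' 0)).ne', fun x hx => ?_⟩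
      obtain ⟨n, hn⟩ := Ordinal.lt_nfp_iff.1 hx
      exact (Order.succ_le_of_lt hn).trans_lt (hlt' n)
    · obtain ⟨n, hn⟩ := Ordinal.lt_nfp_iff.1 hx
      obtain ⟨m, hm⟩ := Ordinal.lt_nfp_iff.1 hy
      have := (hg _ (hit (max n m))).2.2 x (hn.le.trans (hmono.monotone (le_max_left n m))) y
        (hm.le.trans (hmono.monotone (le_max_right n m)))
      rw [← Function.iterate_succ_apply' (f := g)] at this
      exact this.trans (hlt' _)
  · intro x hx y hy
    obtain ⟨z, hz, h1, h2⟩ := hl.2 (max x y) (max_lt hx hy)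
    exact (hz.2.2 x ((le_max_left x y).trans_lt h1) y ((le_max_right x y).trans_lt h1)).trans h2

/-- Every club of `δ` contains all closure points of some function. -/
theorem IsClubIn.exists_next {C : Set Ordinal.{u}} {δ : Ordinal.{u}} (hδ : Order.IsSuccLimit δ)
    (hC : IsClubIn C δ) : ∃ d : Ordinal.{u} → Ordinal.{u}, ∀ x < δ, x < d x ∧ d x ∈ C := by
  have : ∀ x, ∃ y, x < δ → x < y ∧ y ∈ C := fun x => by
    by_cases hx : x < δ
    · obtain ⟨y, hy, h, -⟩ := ((isClubIn_iff hδ).1 hC).2.1.2 x hx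
      exact ⟨y, fun _ => ⟨h, hy⟩⟩
    · exact ⟨0, fun h => absurd h hx⟩
  choose d hd using this
  exact ⟨d, hd⟩

/-- An infinite set of ordinals has a limit point at most equal to any of its upper bounds. -/
theorem exists_isLimPt_of_infinite {A : Set Ordinal.{u}} {y : Ordinal.{u}} (hA : A.Infinite)
    (hy : A ⊆ Iio y) : ∃ b ≤ y, IsLimPt A b := by
  have hne : {b | (A ∩ Iio b).Infinite}.Nonempty := ⟨y, by
    rw [mem_ofPred_eq, inter_eq_left.2 hy]; exact hA⟩
  let b := sInf {b | (A ∩ Iio b).Infinite}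
  have hb : (A ∩ Iio b).Infinite := csInf_mem hne
  have hmin : ∀ x < b, (A ∩ Iio x).Finite := fun x hx => by
    by_contra h
    exact absurd (csInf_le' (s := {b | (A ∩ Iio b).Infinite}) h) (not_le.2 hx)
  refine ⟨b, csInf_le' (by rw [mem_ofPred_eq, inter_eq_left.2 hy]; exact hA), ?_, fun x hx => ?_⟩
  · rw [pos_iff_ne_zero]
    rintro h0
    rw [h0] at hb
    obtain ⟨z, -, hz⟩ := hb.nonempty
    exact absurd hz (by simp)
  · have : ((A ∩ Iio b) \ ((A ∩ Iio x) ∪ {x})).Nonempty :=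
      (hb.sdiff ((hmin x hx).union (finite_singleton x))).nonempty
    obtain ⟨z, ⟨hz, hzb⟩, hz'⟩ := this
    refine ⟨z, hz, ?_, hzb⟩
    simp only [mem_union, mem_inter_iff, mem_Iio, mem_singleton_iff, not_or, not_and, not_lt] at hz'
    exact (hz'.1 hz).lt_of_ne (Ne.symm hz'.2)

theorem IsLimPt.infinite {A : Set Ordinal.{u}} {β : Ordinal.{u}} (h : IsLimPt A β) :
    (A ∩ Iio β).Infinite := by
  intro hfin
  obtain ⟨y, hy, -, hyβ⟩ := h.2 0 h.1
  obtain ⟨m, ⟨hm, hmβ⟩, hmax⟩ := hfin.exists_maximal ⟨y, hy, hyβ⟩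
  obtain ⟨z, hz, h1, h2⟩ := h.2 m hmβ
  exact absurd (hmax ⟨hz, h2⟩ h1.le) (not_le.2 h1)

theorem countable_of_finite_inter_Iio {A : Set Ordinal.{u}} {α : Ordinal.{u}} (hA : A ⊆ Iio α)
    (h : ∀ x < α, (A ∩ Iio x).Finite) : A.Countable := by
  refine MapsTo.countable_of_injOn (f := fun x => (A ∩ Iio x).ncard) (mapsTo_univ _ _) ?_
    countable_univ
  have key : ∀ x ∈ A, ∀ y ∈ A, x < y → (A ∩ Iio x).ncard < (A ∩ Iio y).ncard := fun x hx y hy hxy =>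
    ncard_lt_ncard ⟨inter_subset_inter_right _ (Iio_subset_Iio hxy.le),
      fun hsub => lt_irrefl x (hsub ⟨hx, hxy⟩).2⟩ (h y (hA hy))
  intro x hx y hy hxy
  by_contra hne
  rcases lt_or_gt_of_ne hne with hlt | hlt
  · exact (key x hx y hy hlt).ne hxy
  · exact (key y hy x hx hlt).ne hxy.symm

theorem mem_closurePts_max {δ ε : Ordinal.{u}} {f g : Ordinal.{u} → Ordinal.{u} → Ordinal.{u}} :
    ε ∈ closurePts δ (fun x y => max (f x y) (g x y)) ↔
      ε ∈ closurePts δ f ∧ ε ∈ closurePts δ g := by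
  constructor
  · rintro ⟨h1, h2, h3⟩
    exact ⟨⟨h1, h2, fun x hx y hy => (le_max_left _ _).trans_lt (h3 x hx y hy)⟩,
      ⟨h1, h2, fun x hx y hy => (le_max_right _ _).trans_lt (h3 x hx y hy)⟩⟩
  · rintro ⟨⟨h1, h2, h3⟩, -, -, h4⟩
    exact ⟨h1, h2, fun x hx y hy => max_lt (h3 x hx y hy) (h4 x hx y hy)⟩

/-! ### Pairing, bookkeeping, and guessing of sequences of sets. -/

theorem exists_pairing {κ : Cardinal.{u}} (hκ : ℵ₀ ≤ κ) :
    ∃ p : Ordinal.{u} → Ordinal.{u} → Ordinal.{u},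
      (∀ x < κ.ord, ∀ y < κ.ord, p x y < κ.ord) ∧
      ∀ x < κ.ord, ∀ y < κ.ord, ∀ x' < κ.ord, ∀ y' < κ.ord, p x y = p x' y' → x = x' ∧ y = y' := by
  have : #(Iio κ.ord × Iio κ.ord) = #(Iio κ.ord) := by
    rw [Cardinal.mk_prod, Cardinal.lift_id]
    apply Cardinal.mul_eq_self
    simpa using hκ
  obtain ⟨e⟩ := Cardinal.eq.1 this
  refine ⟨fun x y => if h : x < κ.ord ∧ y < κ.ord then e (⟨x, h.1⟩, ⟨y, h.2⟩) else 0, ?_, ?_⟩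
  · intro x hx y hy
    simp only [hx, hy, and_self, dite_true]
    exact (e _).2
  · intro x hx y hy x' hx' y' hy' h
    simp only [hx, hy, hx', hy', and_self, dite_true] at h
    have := e.injective (Subtype.ext h)
    exact ⟨congrArg (fun t => (t.1 : Ordinal.{u})) this, congrArg (fun t => (t.2 : Ordinal.{u})) this⟩

/-- Every pair of ordinals below an infinite cardinal is listed cofinally often. -/
theorem exists_bookkeeping {μ : Cardinal.{u}} (hμ : ℵ₀ ≤ μ) :
    ∃ g : Ordinal.{u} → Ordinal.{u} × Ordinal.{u}, ∀ m < μ.ord, ∀ ξ < μ.ord,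
      Cardinal.lift.{u + 1} μ ≤ #{b | m < b ∧ b < μ.ord ∧ g b = (m, ξ)} := by
  obtain ⟨p, hp, hinj⟩ := exists_pairing hμ
  classical
  -- The coordinate `z` is idle: it provides `μ` many codes for each pair `(m, ξ)`.
  let q : Ordinal.{u} → Ordinal.{u} → Ordinal.{u} → Ordinal.{u} := fun m ξ z => p (p m ξ) z
  refine ⟨fun b => if h : ∃ t : Ordinal.{u} × Ordinal.{u} × Ordinal.{u}, t.1 < μ.ord ∧
    t.2.1 < μ.ord ∧ t.2.2 < μ.ord ∧ q t.1 t.2.1 t.2.2 = b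
    then (h.choose.1, h.choose.2.1) else (0, 0), fun m hm ξ hξ => ?_⟩
  have key : ∀ z < μ.ord, q m ξ z ∈ {b | b < μ.ord ∧ (if h : ∃ t : Ordinal.{u} × Ordinal.{u} ×
      Ordinal.{u}, t.1 < μ.ord ∧ t.2.1 < μ.ord ∧ t.2.2 < μ.ord ∧ q t.1 t.2.1 t.2.2 = b
      then (h.choose.1, h.choose.2.1) else (0, 0)) = (m, ξ)} := by
    intro z hz
    have hex : ∃ t : Ordinal.{u} × Ordinal.{u} × Ordinal.{u}, t.1 < μ.ord ∧
      t.2.1 < μ.ord ∧ t.2.2 < μ.ord ∧ q t.1 t.2.1 t.2.2 = q m ξ z := ⟨(m, ξ, z), hm, hξ, hz, rfl⟩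
    refine ⟨hp _ (hp _ hm _ hξ) _ hz, ?_⟩
    rw [dif_pos hex]
    obtain ⟨h1, h2, h3, h4⟩ := hex.choose_spec
    have h5 := hinj _ (hp _ h1 _ h2) _ h3 _ (hp _ hm _ hξ) _ hz h4
    have h6 := hinj _ h1 _ h2 _ hm _ hξ h5.1
    exact Prod.ext h6.1 h6.2
  have hle : #(Iio μ.ord) ≤ _ := Cardinal.mk_le_of_injective (f := fun z : Iio μ.ord =>
    (⟨q m ξ z, key z z.2⟩ : {b | b < μ.ord ∧ _})) fun z z' h => by
      have h' : q m ξ z = q m ξ z' := congrArg Subtype.val h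
      exact Subtype.ext (hinj _ (hp _ hm _ hξ) _ z.2 _ (hp _ hm _ hξ) _ z'.2 h').2
  rw [Cardinal.mk_Iio_ordinal, Cardinal.card_ord] at hle
  have hμ' : ℵ₀ ≤ Cardinal.lift.{u + 1} μ := by simpa using hμ
  -- Discarding the codes that are at most `m` costs fewer than `μ` of them.
  have hm' : #(Iic m) < Cardinal.lift.{u + 1} μ := by
    rw [← Order.Iio_succ, Cardinal.mk_Iio_ordinal, Cardinal.lift_lt, ← Cardinal.lt_ord]
    exact (Cardinal.isSuccLimit_ord hμ).succ_lt hm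
  by_contra! hlt
  refine absurd hle (not_le.2 ((Cardinal.le_mk_sdiff_add_mk _ (Iic m)).trans_lt
    (Cardinal.add_lt_of_lt hμ' (lt_of_le_of_lt (Cardinal.mk_le_mk_of_subset ?_) hlt) hm')))
  rintro b ⟨⟨h1, h2⟩, h3⟩
  exact ⟨not_le.1 h3, h1, h2⟩

/-- A sequence of sets of ordinals below `δ`, coded by means of the pairing function `p`. -/
def encode (δ : Ordinal.{u}) (p : Ordinal.{u} → Ordinal.{u} → Ordinal.{u})
    (B : Ordinal.{u} → Set Ordinal.{u}) : Set Ordinal.{u} :=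
  {c | ∃ i < δ, ∃ a < δ, a ∈ B i ∧ p i a = c}

/-- A closure point of `p` contains the codes of all pairs below it, so the code cut at `ε`
determines every `B i ∩ ε` with `i < ε`. -/
theorem decode_inter {κ : Cardinal.{u}} {p : Ordinal.{u} → Ordinal.{u} → Ordinal.{u}}
    (hinj : ∀ x < κ.ord, ∀ y < κ.ord, ∀ x' < κ.ord, ∀ y' < κ.ord,
      p x y = p x' y' → x = x' ∧ y = y')
    {B : Ordinal.{u} → Set Ordinal.{u}} {ε : Ordinal.{u}} (hε : ε ∈ closurePts κ.ord p)
    {Z : Set Ordinal.{u}} (hZ : encode κ.ord p B ∩ Iio ε = Z) {i : Ordinal.{u}} (hi : i < ε) :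
    {a | p i a ∈ Z} ∩ Iio ε = B i ∩ Iio ε := by
  ext a
  simp only [mem_inter_iff, mem_ofPred_eq, mem_Iio, ← hZ]
  refine and_congr_left fun ha => ?_
  have hi' := hi.trans hε.1
  have ha' := ha.trans hε.1
  constructor
  · rintro ⟨⟨j, hj, b, hb, hbj, h⟩, -⟩
    obtain ⟨rfl, rfl⟩ := hinj _ hj _ hb _ hi' _ ha' h
    exact hbj
  · exact fun h => ⟨⟨i, hi', a, ha', h, rfl⟩, hε.2.2 _ hi _ ha⟩

theorem encode_subset {κ : Cardinal.{u}} {p : Ordinal.{u} → Ordinal.{u} → Ordinal.{u}}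
    (hp : ∀ x < κ.ord, ∀ y < κ.ord, p x y < κ.ord) {B : Ordinal.{u} → Set Ordinal.{u}} :
    encode κ.ord p B ⊆ Iio κ.ord := by
  rintro _ ⟨i, hi, a, ha, -, rfl⟩
  exact hp _ hi _ ha

theorem Diamond.exists_guess {κ : Cardinal.{u}} (hκ : κ.IsRegular) (hκ' : ℵ₀ < κ)
    {S : Set Ordinal.{u}} (hS : Diamond κ S) :
    ∃ 𝔅 : Ordinal.{u} → Ordinal.{u} → Set Ordinal.{u}, ∀ B : Ordinal.{u} → Set Ordinal.{u},
      ∀ f : Ordinal.{u} → Ordinal.{u} → Ordinal.{u},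
        (∀ x < κ.ord, ∀ y < κ.ord, f x y < κ.ord) →
        ∃ α ∈ S, α ∈ closurePts κ.ord f ∧ ∀ i < α, 𝔅 α i ∩ Iio α = B i ∩ Iio α := by
  obtain ⟨Z, -, hZ⟩ := hS
  obtain ⟨p, hp, hinj⟩ := exists_pairing hκ.aleph0_le
  refine ⟨fun α i => {a | p i a ∈ Z α}, fun B f hf => ?_⟩
  obtain ⟨α, ⟨hαS, hα⟩, hαf⟩ := (hZ _ (encode_subset hp (B := B))).exists_mem
    (isClubIn_closurePts hκ hκ' (f := fun x y => max (f x y) (p x y))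
      fun x hx y hy => max_lt (hf x hx y hy) (hp x hx y hy))
  rw [mem_closurePts_max] at hαf
  exact ⟨α, hαS, hαf.1, fun i hi => decode_inter hinj hαf.2 hα hi⟩

/-! ### Ladders and order types. -/

/-- A coherent system of closed sets of limit points, together with a matching diamond-like
guessing of sequences of sets. -/
structure Ladder (lam : Cardinal.{u}) (S : Set Ordinal.{u}) (T : Ordinal.{u} → Set Ordinal.{u})
    (𝔅 : Ordinal.{u} → Ordinal.{u} → Set Ordinal.{u}) : Prop where
  lt : ∀ α < (Order.succ lam).ord, Order.IsSuccLimit α → ∀ ε ∈ T α, ε < α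
  isSuccLimit : ∀ α < (Order.succ lam).ord, Order.IsSuccLimit α → ∀ ε ∈ T α, Order.IsSuccLimit ε
  coherent : ∀ α < (Order.succ lam).ord, Order.IsSuccLimit α → ∀ ε ∈ T α, T ε = T α ∩ Iio ε
  closed : ∀ α < (Order.succ lam).ord, Order.IsSuccLimit α → ∀ β < α, IsLimPt (T α) β → β ∈ T α
  card_lt : ∀ α < (Order.succ lam).ord, Order.IsSuccLimit α → ∀ ε ∈ T α,
    #(T ε) < Cardinal.lift.{u + 1} lam
  bounded : ∀ α < (Order.succ lam).ord, Order.IsSuccLimit α → ¬ IsLimPt (T α) α →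
    #(T α) < Cardinal.lift.{u + 1} lam ∧
      ∃ F ⊆ Iio α, F.Countable ∧ IsLimPt F α
  guess : ∀ B : Ordinal.{u} → Set Ordinal.{u}, ∀ f : Ordinal.{u} → Ordinal.{u} → Ordinal.{u},
    (∀ x < (Order.succ lam).ord, ∀ y < (Order.succ lam).ord, f x y < (Order.succ lam).ord) →
    ∃ α ∈ S, α < (Order.succ lam).ord ∧ Order.IsSuccLimit α ∧ IsLimPt (T α) α ∧
      otp (T α) = Ordinal.lift.{u + 1} lam.ord ∧ ∀ ε ∈ T α, ε ∈ closurePts (Order.succ lam).ord f ∧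
        ∀ i < ε, 𝔅 ε i ∩ Iio ε = B i ∩ Iio ε

theorem card_otp (D : Set Ordinal.{u}) : (otp D).card = #D := Ordinal.card_type _

theorem otp_mono {C D : Set Ordinal.{u}} (h : C ⊆ D) : otp C ≤ otp D := Ordinal.type_mono h

theorem otp_inter_Iio {D : Set Ordinal.{u}} (x : D) :
    otp (D ∩ Iio x.1) = Ordinal.typein ((· < ·) : D → D → Prop) x := by
  rw [← Ordinal.type_Iio_lt]
  refine Ordinal.type_eq.2 ⟨⟨⟨fun y => ⟨⟨y.1, y.2.1⟩, y.2.2⟩, fun y => ⟨y.1.1, y.1.2, y.2⟩,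
    fun y => rfl, fun y => rfl⟩, fun {a b} => Iff.rfl⟩⟩

theorem otp_inter_Iio_lt_iff {D : Set Ordinal.{u}} {x y : Ordinal.{u}} (hx : x ∈ D) (hy : y ∈ D) :
    otp (D ∩ Iio x) < otp (D ∩ Iio y) ↔ x < y := by
  rw [otp_inter_Iio ⟨x, hx⟩, otp_inter_Iio ⟨y, hy⟩, Ordinal.typein_lt_typein]
  exact Iff.rfl

theorem otp_inter_Iio_lt {D : Set Ordinal.{u}} {x : Ordinal.{u}} (hx : x ∈ D) :
    otp (D ∩ Iio x) < otp D := by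
  rw [otp_inter_Iio ⟨x, hx⟩]
  exact Ordinal.typein_lt_type _ _

theorem exists_otp_inter_Iio_eq {D : Set Ordinal.{u}} {o : Ordinal.{u + 1}} (ho : o < otp D) :
    ∃ x ∈ D, otp (D ∩ Iio x) = o := by
  obtain ⟨x, hx⟩ := Ordinal.typein_surj ((· < ·) : D → D → Prop) ho
  exact ⟨x, x.2, by rw [otp_inter_Iio, hx]⟩

theorem mk_lt_of_otp_lt {D : Set Ordinal.{u}} {lam : Cardinal.{u}}
    (h : otp D < Ordinal.lift.{u + 1} lam.ord) : #D < Cardinal.lift.{u + 1} lam := by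
  rwa [Cardinal.lift_ord, Cardinal.lt_ord, card_otp] at h

theorem mk_eq_of_otp_eq {D : Set Ordinal.{u}} {lam : Cardinal.{u}}
    (h : otp D = Ordinal.lift.{u + 1} lam.ord) : #D = Cardinal.lift.{u + 1} lam := by
  rw [← card_otp, h, Cardinal.lift_ord, Cardinal.card_ord]

/-- This places the points supplied by `SD_λ` in `E^{λ⁺}_{cf λ}`. -/
theorem cof_eq_of_otp_eq {T : Set Ordinal.{u}} {α β : Ordinal.{u}} (hT : T ⊆ Iio α)
    (hα : IsLimPt T α) (h : otp T = Ordinal.lift.{u + 1} β) : α.cof = β.cof := by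
  have h1 : StrictMono (fun x : T => (⟨x.1, hT x.2⟩ : Iio α)) := fun x y hxy => hxy
  have h2 := Order.cof_congr_of_strictMono h1 (by
    intro x
    obtain ⟨y, hy, hxy, -⟩ := hα.2 x x.2
    exact ⟨⟨y, hT hy⟩, ⟨⟨y, hy⟩, rfl⟩, hxy.le⟩)
  rw [Ordinal.cof_Iio, ← Ordinal.cof_type] at h2
  change (otp T).cof = _ at h2
  rw [h, ← Ordinal.lift_cof, ← Ordinal.lift_cof, Cardinal.lift_inj] at h2
  exact h2.symm

/-! ### Ladders from the combined square and diamond. -/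

section SquareDiamond

variable {lam : Cardinal.{u}}

theorem omega_mul_ord (hlam : ℵ₀ < lam) : ω * lam.ord = lam.ord :=
  Ordinal.isPrincipal_mul_iff_mul_left_eq.1 (Ordinal.isPrincipal_mul_ord hlam.le) _
    Ordinal.omega0_pos (Cardinal.omega0_lt_ord.2 hlam)

theorem mem_acc_iff_of_isClubIn {C : Set Ordinal.{u}} {α β : Ordinal.{u}}
    (hα : Order.IsSuccLimit α) (h : IsClubIn C α) : β ∈ acc C ↔ β ∈ C ∧ IsLimPt C β :=
  mem_acc_iff ((isClubIn_iff hα).1 h).2.1 h.1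

/-- If `acc C` is bounded by `x < α`, it lies in a proper initial segment of `C`, hence is small.
The tail of `C` above `x` has finite initial segments, since an infinite one would create an
accumulation point above `x`; so this tail is countable and cofinal. -/
theorem acc_bounded_of_otp_le {C : Set Ordinal.{u}} {α : Ordinal.{u}} (hα : Order.IsSuccLimit α)
    (h : IsClubIn C α) (hC : otp C ≤ Ordinal.lift.{u + 1} lam.ord) (hacc : ¬ IsLimPt (acc C) α) :
    #(acc C) < Cardinal.lift.{u + 1} lam ∧
      ∃ F ⊆ Iio α, F.Countable ∧ IsLimPt F α := by
  obtain ⟨hCα, hlim, hcl⟩ := (isClubIn_iff hα).1 h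
  have hα0 : 0 < α := hlim.1
  obtain ⟨x, hx, hbd⟩ : ∃ x < α, ∀ y ∈ acc C, y ≤ x := by
    by_contra! hcon
    refine hacc ⟨hα0, fun x hx => ?_⟩
    obtain ⟨y, hy, hxy⟩ := hcon x hx
    exact ⟨y, hy, hxy, hCα hy.1⟩
  obtain ⟨z, hz, hxz, -⟩ := hlim.2 x hx
  constructor
  · refine (Cardinal.mk_le_mk_of_subset (t := C ∩ Iio z) fun y hy =>
      ⟨hy.1, (hbd y hy).trans_lt hxz⟩).trans_lt ?_
    exact mk_lt_of_otp_lt ((otp_inter_Iio_lt hz).trans_le hC)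
  · refine ⟨C \ Iic x, fun y hy => hCα hy.1,
      countable_of_finite_inter_Iio (fun y hy => hCα hy.1) fun y hy => ?_,
      ⟨hα0, fun y hy => ?_⟩⟩
    rotate_left
    · obtain ⟨w, hw, h1, h2⟩ := hlim.2 (max x y) (max_lt hx hy)
      exact ⟨w, ⟨hw, not_le.2 ((le_max_left _ _).trans_lt h1)⟩, (le_max_right _ _).trans_lt h1, h2⟩
    · by_contra hinf
      obtain ⟨b, hb, hbl⟩ := exists_isLimPt_of_infinite hinf inter_subset_right
      have hbC : IsLimPt C b := hbl.mono fun z hz _ => hz.1.1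
      have hb' : b ∈ acc C := (mem_acc_iff hlim hCα).2 ⟨hcl b (hb.trans_lt hy) hbC, hbC⟩
      obtain ⟨z, hz, -, hzb⟩ := hbl.2 0 hbl.1
      exact hz.1.2 (hzb.le.trans (hbd b hb'))

/-- As `ω · λ = λ` here, proper initial segments of `D α` have size below `λ`. The club handed to
`SD_λ` consists of closure points of both `f` and the pairing function, so the coded sequence can be
decoded at every accumulation point of `D α`. -/
theorem SquareDiamond.exists_ladder (hlam : ℵ₀ < lam) (h : SquareDiamond lam) :
    ∃ T 𝔅, Ladder lam (cofSet (Order.succ lam) lam.ord.cof) T 𝔅 := by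
  have hreg := Cardinal.isRegular_succ hlam.le
  have hunc := hlam.trans (Order.lt_succ lam)
  obtain ⟨p, hp, hinj⟩ := exists_pairing hreg.aleph0_le
  obtain ⟨D, X, hD, hcoh, hguess⟩ := h
  rw [omega_mul_ord hlam] at hD
  have hmem : ∀ α < (Order.succ lam).ord, Order.IsSuccLimit α → ∀ ε, ε ∈ acc (D α) ↔
      ε ∈ D α ∧ IsLimPt (D α) ε :=
    fun α hα hl ε => mem_acc_iff_of_isClubIn hl (hD α hα hl).1
  have hlt : ∀ α < (Order.succ lam).ord, Order.IsSuccLimit α → ∀ ε ∈ acc (D α), ε < α :=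
    fun α hα hl ε hε => (hD α hα hl).1.1 hε.1
  have hbdd : ∀ α < (Order.succ lam).ord, Order.IsSuccLimit α → ¬ IsLimPt (acc (D α)) α →
      #(acc (D α)) < Cardinal.lift.{u + 1} lam ∧
      ∃ F ⊆ Iio α, F.Countable ∧ IsLimPt F α :=
    fun α hα hl => acc_bounded_of_otp_le hl (hD α hα hl).1 (hD α hα hl).2.1
  refine ⟨fun α => acc (D α), fun α i => {a | p i a ∈ X α}, hlt, ?_, ?_, ?_, ?_, hbdd, ?_⟩
  · intro α hα hl ε hε
    exact ((hmem α hα hl ε).1 hε).2.isSuccLimit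
  · intro α hα hl ε hε
    have hεα := hlt α hα hl ε hε
    have hεl := ((hmem α hα hl ε).1 hε).2.isSuccLimit
    ext β
    rw [hmem ε (hεα.trans hα) hεl, ← (hcoh α hα ε hε).1]
    constructor
    · rintro ⟨⟨h1, h2⟩, h3⟩
      exact ⟨(hmem α hα hl β).2 ⟨h1, h3.mono fun x hx _ => hx.1⟩, h2⟩
    · rintro ⟨h1, h2⟩
      have h3 := (hmem α hα hl β).1 h1
      exact ⟨⟨h3.1, h2⟩, h3.2.mono fun x hx hxβ => ⟨hx, hxβ.trans h2⟩⟩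
  · intro α hα hl β hβ hlim
    have h1 : IsLimPt (D α) β := hlim.mono fun x hx _ => hx.1
    exact (hmem α hα hl β).2 ⟨((isClubIn_iff hl).1 (hD α hα hl).1).2.2 β hβ h1, h1⟩
  · intro α hα hl ε hε
    refine (Cardinal.mk_le_mk_of_subset (t := D α ∩ Iio ε) ?_).trans_lt
      (mk_lt_of_otp_lt ((otp_inter_Iio_lt hε.1).trans_le (hD α hα hl).2.1))
    rw [(hcoh α hα ε hε).1]
    exact inter_subset_left
  · intro B f hf
    obtain ⟨α, hα, hl, hotp, hXα, hE⟩ := hguess _ (encode_subset hp (B := B)) _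
      (isClubIn_closurePts hreg hunc (f := fun x y => max (f x y) (p x y))
        fun x hx y hy => max_lt (hf x hx y hy) (hp x hx y hy))
    have hlim : IsLimPt (acc (D α)) α := by
      by_contra hcon
      exact (hbdd α hα hl hcon).1.ne (mk_eq_of_otp_eq hotp)
    refine ⟨α, ⟨hα, cof_eq_of_otp_eq (hlt α hα hl) hlim hotp⟩, hα, hl, hlim, hotp,
      fun ε hε => ?_⟩
    have hεf := mem_closurePts_max.1 (hE hε)
    refine ⟨hεf.1, fun i hi => decode_inter hinj hεf.2 ?_ hi⟩
    rw [← (hcoh α hα ε hε).2, ← hXα, inter_assoc,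
      inter_eq_right.2 (Iio_subset_Iio (hlt α hα hl ε hε).le)]

/-- The guessing point `α` belongs to the club `C`: having order type `λ`, the set `acc (D α)` is
too large to be bounded in `α`, and it is contained in `C`. -/
theorem SquareDiamond.diamond (hlam : ℵ₀ < lam) (h : SquareDiamond lam) :
    Diamond (Order.succ lam) (Iio (Order.succ lam).ord) := by
  classical
  have hreg := Cardinal.isRegular_succ hlam.le
  have hlimκ := Cardinal.isSuccLimit_ord hreg.aleph0_le
  obtain ⟨D, X, hD, hcoh, hguess⟩ := h
  rw [omega_mul_ord hlam] at hD
  refine ⟨fun α => if Order.IsSuccLimit α then X α else ∅, fun β hβ => ?_, fun Y hY => ?_⟩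
  · by_cases hl : Order.IsSuccLimit β
    · simpa [hl] using (hD β hβ hl).2.2
    · simp [hl]
  · refine isStationaryIn_of_forall (fun x hx => hx.1) fun C hC => ?_
    obtain ⟨α, hα, hl, hotp, hXα, hE⟩ := hguess Y hY C hC
    refine ⟨α, ⟨hα, by simpa [hl] using hXα⟩, ?_⟩
    refine ((isClubIn_iff hlimκ).1 hC).2.2 α hα ?_
    by_contra hcon
    refine (acc_bounded_of_otp_le hl (hD α hα hl).1 (hD α hα hl).2.1 fun h => hcon ?_).1.ne
      (mk_eq_of_otp_eq hotp)
    exact h.mono fun x hx _ => hE hx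

end SquareDiamond

/-! ### Ladders from diamond on `ω₁`. -/

theorem Diamond.mono {κ : Cardinal.{u}} {S S' : Set Ordinal.{u}} (hSS' : S ⊆ S')
    (hS' : S' ⊆ Iio κ.ord)     (h : Diamond κ S) : Diamond κ S' := by
  obtain ⟨Z, hZ, hg⟩ := h
  classical
  refine ⟨fun β => if β ∈ S then Z β else ∅, fun β _ => ?_, fun X hX =>
    isStationaryIn_of_forall (fun β hβ => ?_) fun C hC => ?_⟩
  · by_cases h : β ∈ S
    · simpa [h] using hZ β h
    · simp [h]
  · exact hS' hβ.1
  · obtain ⟨α, ⟨h1, h2⟩, h3⟩ := (hg X hX).exists_mem hC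
    exact ⟨α, ⟨hSS' h1, by simpa [h1] using h2⟩, h3⟩

theorem countable_Iio_of_lt {α : Ordinal.{u}} (hα : α < (Order.succ (ℵ₀ : Cardinal.{u})).ord) :
    (Iio α).Countable := by
  rw [← Cardinal.le_aleph0_iff_set_countable, Cardinal.mk_Iio_ordinal, Cardinal.lift_le_aleph0]
  exact Order.lt_succ_iff.1 (Cardinal.lt_ord.1 hα)

theorem otp_range_of_strictMono {e : ℕ → Ordinal.{u}} (he : StrictMono e) : otp (range e) = ω := by
  have h := Ordinal.lift_type_eq.{0, u + 1, 0}.2 ⟨(StrictMono.orderIso e he).toRelIsoLT⟩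
  rw [Ordinal.type_nat_lt] at h
  simpa using! h.symm

section Tree

variable (𝔅 : Ordinal.{u} → Ordinal.{u} → Set Ordinal.{u})

/-- `γ` guesses some predecessor. -/
def HasGuess (γ : Ordinal.{u}) : Prop := (𝔅 γ 0 ∩ Iio γ).Nonempty

open Classical in
/-- The predecessor of `γ` that is guessed at `γ`, if it is legitimate, and `0` otherwise. -/
noncomputable def predGuess (γ : Ordinal.{u}) : Ordinal.{u} :=
  if Order.IsSuccLimit (sInf (𝔅 γ 0 ∩ Iio γ)) ∧ HasGuess 𝔅 (sInf (𝔅 γ 0 ∩ Iio γ)) ∧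
    sInf (𝔅 γ 0 ∩ Iio γ) < γ then sInf (𝔅 γ 0 ∩ Iio γ) else 0

/-- The finite set of the iterated guessed predecessors of `γ`. -/
def predSet (γ : Ordinal.{u}) : Set Ordinal.{u} :=
  {x | x ≠ 0 ∧ ∃ n, (predGuess 𝔅)^[n + 1] γ = x}

variable {𝔅}

theorem predGuess_of_ne_zero {γ : Ordinal.{u}} (h : predGuess 𝔅 γ ≠ 0) :
    Order.IsSuccLimit (predGuess 𝔅 γ) ∧ HasGuess 𝔅 (predGuess 𝔅 γ) ∧ predGuess 𝔅 γ < γ := by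
  by_cases hc : Order.IsSuccLimit (sInf (𝔅 γ 0 ∩ Iio γ)) ∧
    HasGuess 𝔅 (sInf (𝔅 γ 0 ∩ Iio γ)) ∧ sInf (𝔅 γ 0 ∩ Iio γ) < γ
  · simp only [predGuess, hc, and_self, if_true]
  · exact absurd (if_neg hc) h

theorem predGuess_le (γ : Ordinal.{u}) : predGuess 𝔅 γ ≤ γ := by
  by_cases h : predGuess 𝔅 γ = 0
  · rw [h]; exact zero_le
  · exact (predGuess_of_ne_zero h).2.2.le

theorem predGuess_iterate_le (γ : Ordinal.{u}) (n : ℕ) : (predGuess 𝔅)^[n] γ ≤ γ := by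
  induction n with
  | zero => rfl
  | succ n ih =>
    rw [Function.iterate_succ_apply']
    exact (predGuess_le _).trans ih

theorem of_mem_predSet {γ x : Ordinal.{u}} (h : x ∈ predSet 𝔅 γ) :
    Order.IsSuccLimit x ∧ HasGuess 𝔅 x ∧ x < γ := by
  obtain ⟨h0, n, rfl⟩ := h
  rw [Function.iterate_succ_apply'] at h0 ⊢
  have := predGuess_of_ne_zero h0
  exact ⟨this.1, this.2.1, this.2.2.trans_le (predGuess_iterate_le γ n)⟩

/-- `predSet` is the nonzero part of a descending orbit, and the orbit of one of its points is a
tail of it. -/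
theorem predSet_coherent {γ ε : Ordinal.{u}} (h : ε ∈ predSet 𝔅 γ) :
    predSet 𝔅 ε = predSet 𝔅 γ ∩ Iio ε := by
  obtain ⟨h0, n, hn⟩ := id h
  ext x
  constructor
  · rintro hx
    obtain ⟨hx0, m, rfl⟩ := id hx
    refine ⟨⟨hx0, m + 1 + n, ?_⟩, (of_mem_predSet hx).2.2⟩
    rw [← hn, ← Function.iterate_add_apply]
    rfl
  · rintro ⟨⟨hx0, m, rfl⟩, hlt⟩
    refine ⟨hx0, ?_⟩
    rcases lt_or_ge n m with hnm | hnm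
    · obtain ⟨k, rfl⟩ := Nat.exists_eq_add_of_lt hnm
      refine ⟨k, ?_⟩
      rw [← hn, ← Function.iterate_add_apply]
      congr 1
      omega
    · obtain ⟨k, rfl⟩ := Nat.exists_eq_add_of_le hnm
      have : ε = (predGuess 𝔅)^[k] ((predGuess 𝔅)^[m + 1] γ) := by
        rw [← Function.iterate_add_apply, ← hn]
        congr 1
        omega
      rw [this] at hlt
      exact absurd (predGuess_iterate_le _ k) (not_le.2 hlt)

theorem predGuess_zero : predGuess 𝔅 0 = 0 := nonpos_iff_eq_zero.1 (predGuess_le 0)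

theorem finite_predSet (γ : Ordinal.{u}) : (predSet 𝔅 γ).Finite := by
  induction γ using WellFoundedLT.induction with
  | ind γ ih =>
    by_cases h : predGuess 𝔅 γ = 0
    · convert finite_empty (α := Ordinal.{u})
      rw [eq_empty_iff_forall_notMem]
      rintro x ⟨hx0, n, rfl⟩
      rw [Function.iterate_succ_apply, h] at hx0
      exact hx0 (Function.iterate_fixed predGuess_zero n)
    · refine ((ih _ (predGuess_of_ne_zero h).2.2).insert (predGuess 𝔅 γ)).subset ?_
      rintro x ⟨hx0, n, rfl⟩
      cases n with
      | zero => exact Or.inl rfl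
      | succ n => exact Or.inr ⟨hx0, n, rfl⟩

variable (𝔅) in
/-- `e` is a cofinal branch below `α` through the tree of guessed predecessors, along which the
guesses agree with the guess at `α`. -/
structure IsBranch (α : Ordinal.{u}) (e : ℕ → Ordinal.{u}) : Prop where
  zero : predGuess 𝔅 (e 0) = 0
  succ : ∀ n, predGuess 𝔅 (e (n + 1)) = e n
  hasGuess : ∀ n, HasGuess 𝔅 (e n)
  isSuccLimit : ∀ n, Order.IsSuccLimit (e n)
  lt : ∀ n, e n < α
  cofinal : ∀ x < α, ∃ n, x < e n
  mem : ∀ n, e n ∈ 𝔅 α 1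
  agree : ∀ n, ∀ i < e n, 𝔅 (e n) (2 + i) ∩ Iio (e n) = 𝔅 α (2 + i) ∩ Iio (e n)

theorem IsBranch.strictMono {α : Ordinal.{u}} {e : ℕ → Ordinal.{u}} (h : IsBranch 𝔅 α e) :
    StrictMono e := by
  refine strictMono_nat_of_lt_succ fun n => ?_
  have := @predGuess_of_ne_zero 𝔅 (e (n + 1)) (by
    rw [h.succ]; exact (Ordinal.isSuccLimit_iff.1 (h.isSuccLimit n)).1)
  rw [h.succ] at this
  exact this.2.2

theorem IsBranch.iterate_add {α : Ordinal.{u}} {e : ℕ → Ordinal.{u}} (h : IsBranch 𝔅 α e)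
    (k m : ℕ) : (predGuess 𝔅)^[k] (e (m + k)) = e m := by
  induction k with
  | zero => rfl
  | succ k ih => rw [Function.iterate_succ_apply, ← add_assoc, h.succ, ih]

theorem IsBranch.iterate {α : Ordinal.{u}} {e : ℕ → Ordinal.{u}} (h : IsBranch 𝔅 α e)
    (k n : ℕ) : (predGuess 𝔅)^[k] (e n) = 0 ∨ (predGuess 𝔅)^[k] (e n) ∈ range e := by
  induction k with
  | zero => exact Or.inr ⟨n, rfl⟩
  | succ k ih =>
    rw [Function.iterate_succ_apply']
    rcases ih with ih | ⟨m, hm⟩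
    · rw [ih, predGuess_zero]; exact Or.inl rfl
    · rw [← hm]
      cases m with
      | zero => exact Or.inl h.zero
      | succ m => exact Or.inr ⟨m, (h.succ m).symm⟩

theorem IsBranch.predSet_eq {α : Ordinal.{u}} {e : ℕ → Ordinal.{u}} (h : IsBranch 𝔅 α e) (n : ℕ) :
    predSet 𝔅 (e n) = range e ∩ Iio (e n) := by
  ext x
  constructor
  · intro hx
    refine ⟨?_, (of_mem_predSet hx).2.2⟩
    obtain ⟨h0, k, rfl⟩ := hx
    exact (h.iterate (k + 1) n).resolve_left h0
  · rintro ⟨⟨m, rfl⟩, hlt⟩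
    obtain ⟨k, rfl⟩ := Nat.exists_eq_add_of_lt (h.strictMono.lt_iff_lt.1 hlt)
    exact ⟨(Ordinal.isSuccLimit_iff.1 (h.isSuccLimit m)).1, k, h.iterate_add (k + 1) m⟩

open Classical in
variable (𝔅) in
/-- The branch below `α`, if there is one, and the predecessors of `α` otherwise. -/
noncomputable def branchSet (α : Ordinal.{u}) : Set Ordinal.{u} :=
  if h : ¬ HasGuess 𝔅 α ∧ ∃ e, IsBranch 𝔅 α e then range h.2.choose else predSet 𝔅 α

theorem branchSet_of_hasGuess {α : Ordinal.{u}} (h : HasGuess 𝔅 α) :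
    branchSet 𝔅 α = predSet 𝔅 α := dif_neg fun h' => h'.1 h

theorem branchSet_of_exists {α : Ordinal.{u}} (h : ¬ HasGuess 𝔅 α) (he : ∃ e, IsBranch 𝔅 α e) :
    ∃ e, IsBranch 𝔅 α e ∧ branchSet 𝔅 α = range e :=
  ⟨_, he.choose_spec, dif_pos ⟨h, he⟩⟩

theorem branchSet_cases (α : Ordinal.{u}) :
    branchSet 𝔅 α = predSet 𝔅 α ∨ ∃ e, IsBranch 𝔅 α e ∧ branchSet 𝔅 α = range e := by
  by_cases h : ¬ HasGuess 𝔅 α ∧ ∃ e, IsBranch 𝔅 α e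
  · exact Or.inr (branchSet_of_exists h.1 h.2)
  · exact Or.inl (dif_neg h)

theorem of_mem_branchSet {α ε : Ordinal.{u}} (hε : ε ∈ branchSet 𝔅 α) :
    Order.IsSuccLimit ε ∧ HasGuess 𝔅 ε ∧ ε < α := by
  rcases branchSet_cases (𝔅 := 𝔅) α with h | ⟨e, he, h⟩
  · rw [h] at hε
    exact of_mem_predSet hε
  · rw [h] at hε
    obtain ⟨n, rfl⟩ := hε
    exact ⟨he.isSuccLimit n, he.hasGuess n, he.lt n⟩

/-- Nodes of the tree satisfy `HasGuess`, while a branch is attached only to ordinals that do not.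
Hence at a node `branchSet` is always `predSet`. -/
theorem branchSet_coherent {α ε : Ordinal.{u}} (hε : ε ∈ branchSet 𝔅 α) :
    branchSet 𝔅 ε = branchSet 𝔅 α ∩ Iio ε := by
  rw [branchSet_of_hasGuess (of_mem_branchSet hε).2.1]
  rcases branchSet_cases (𝔅 := 𝔅) α with h | ⟨e, he, h⟩
  · rw [h] at hε ⊢
    exact predSet_coherent hε
  · rw [h] at hε ⊢
    obtain ⟨n, rfl⟩ := hε
    exact he.predSet_eq n

theorem finite_branchSet_inter {α x : Ordinal.{u}} (hx : x < α) :
    (branchSet 𝔅 α ∩ Iio x).Finite := by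
  rcases branchSet_cases (𝔅 := 𝔅) α with h | ⟨e, he, h⟩
  · rw [h]
    exact (finite_predSet α).inter_of_left _
  · rw [h]
    obtain ⟨n, hn⟩ := he.cofinal x hx
    refine (finite_predSet (𝔅 := 𝔅) (e n)).subset ?_
    rw [he.predSet_eq]
    exact inter_subset_inter_right _ (Iio_subset_Iio hn.le)

end Tree

open Classical in
/-- The sequence of sets that starts with `P` and `E` and continues with `B`. -/
noncomputable def consTwo (P E : Set Ordinal.{u}) (B : Ordinal.{u} → Set Ordinal.{u})
    (i : Ordinal.{u}) : Set Ordinal.{u} :=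
  if i = 0 then P else if i = 1 then E else B (i - 2)

theorem consTwo_zero (P E : Set Ordinal.{u}) (B : Ordinal.{u} → Set Ordinal.{u}) :
    consTwo P E B 0 = P := if_pos rfl

theorem consTwo_one (P E : Set Ordinal.{u}) (B : Ordinal.{u} → Set Ordinal.{u}) :
    consTwo P E B 1 = E := by simp [consTwo]

theorem consTwo_two_add (P E : Set Ordinal.{u}) (B : Ordinal.{u} → Set Ordinal.{u})
    (i : Ordinal.{u}) : consTwo P E B (2 + i) = B i := by
  have h : (1 : Ordinal.{u}) < 2 + i := one_lt_two.trans_le le_self_add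
  rw [consTwo, if_neg (zero_lt_one.trans h).ne', if_neg h.ne', Ordinal.add_sub_cancel]

theorem two_add_lt {i ε : Ordinal.{u}} (hε : Order.IsSuccLimit ε) (hi : i < ε) : 2 + i < ε := by
  have := Ordinal.natCast_add_of_omega0_le (Ordinal.omega0_le_of_isSuccLimit hε) 2
  rw [← this]
  exact (add_lt_add_iff_left _).2 hi

/-- Slot 0 of a guess holds the predecessor and slot 1 the set of closure points; the ladder exposes
only the slots `2 + i`. Proper initial segments of `T α` are finite, so closedness is vacuous, and a
gap at `α` is filled using that `α` itself is countable. -/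
theorem Diamond.exists_ladder {S : Set Ordinal.{u}}
    (h : Diamond (Order.succ (ℵ₀ : Cardinal.{u})) S) : ∃ T 𝔅, Ladder ℵ₀ S T 𝔅 := by
  have hreg := Cardinal.isRegular_succ (le_refl (ℵ₀ : Cardinal.{u}))
  have hunc := Order.lt_succ (ℵ₀ : Cardinal.{u})
  have hlimκ := Cardinal.isSuccLimit_ord hreg.aleph0_le
  obtain ⟨𝔅, h𝔅⟩ := h.exists_guess hreg hunc
  refine ⟨branchSet 𝔅, fun α i => 𝔅 α (2 + i), fun α _ _ ε hε => (of_mem_branchSet hε).2.2,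
    fun α _ _ ε hε => (of_mem_branchSet hε).1, fun α _ _ ε hε => branchSet_coherent hε,
    fun α _ _ β hβ hl => absurd (finite_branchSet_inter hβ) hl.infinite, fun α _ _ ε hε => ?_,
    fun α hα hl hT => ⟨?_, Iio α, subset_rfl, countable_Iio_of_lt hα, hl.bot_lt, fun x hx => ?_⟩, ?_⟩
  · rw [Cardinal.lift_aleph0, Cardinal.lt_aleph0_iff_set_finite,
      branchSet_of_hasGuess (of_mem_branchSet hε).2.1]
    exact finite_predSet ε
  · rw [Cardinal.lift_aleph0, Cardinal.lt_aleph0_iff_set_finite]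
    rcases branchSet_cases (𝔅 := 𝔅) α with h | ⟨e, he, h⟩
    · rw [h]
      exact finite_predSet α
    · refine absurd ⟨hl.bot_lt, fun x hx => ?_⟩ hT
      rw [h]
      obtain ⟨n, hn⟩ := he.cofinal x hx
      exact ⟨e n, ⟨n, rfl⟩, hn, he.lt n⟩
  · exact ⟨Order.succ x, hl.succ_lt hx, Order.lt_succ x, hl.succ_lt hx⟩
  · intro B f hf
    let E := closurePts (Order.succ (ℵ₀ : Cardinal.{u})).ord f
    have hex : ∀ a e, ∃ γ, a < (Order.succ (ℵ₀ : Cardinal.{u})).ord →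
        e < (Order.succ (ℵ₀ : Cardinal.{u})).ord → γ ∈ E ∧ a < γ ∧ e < γ ∧
          ∀ i < γ, 𝔅 γ i ∩ Iio γ = consTwo {e} E B i ∩ Iio γ := by
      intro a e
      by_cases hae : a < (Order.succ (ℵ₀ : Cardinal.{u})).ord ∧
        e < (Order.succ (ℵ₀ : Cardinal.{u})).ord
      -- Closure under the constant `max a e` forces `γ` above both `a` and `e`.
      · obtain ⟨γ, -, hγ, hγB⟩ := h𝔅 (consTwo {e} E B) (fun x y => max (f x y) (max a e))
          fun x hx y hy => max_lt (hf x hx y hy) (max_lt hae.1 hae.2)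
        have hγ' := (mem_closurePts_max (g := fun _ _ => max a e)).1 hγ
        have hpos := hγ'.1.2.1.bot_lt
        have hlt := hγ'.2.2.2 _ hpos _ hpos
        exact ⟨γ, fun _ _ => ⟨hγ'.1, (le_max_left _ _).trans_lt hlt,
          (le_max_right _ _).trans_lt hlt, hγB⟩⟩
      · exact ⟨0, fun h1 h2 => absurd ⟨h1, h2⟩ hae⟩
    choose G hG using hex
    -- The empty slot 0 marks `α` as a top rather than a node, and closure under `G` lets a branch
    -- be built below it.
    obtain ⟨α, hαS, hα, hαB⟩ := h𝔅 (consTwo ∅ E B) (fun x y => max (f x y) (G x y))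
      fun x hx y hy => max_lt (hf x hx y hy) (hG x y hx hy).1.1
    obtain ⟨hαf, hακ, hαl, hαG⟩ := mem_closurePts_max.1 hα
    have hα1 := Ordinal.one_lt_of_isSuccLimit hαl
    have hα0 : ¬ HasGuess 𝔅 α := by
      rw [HasGuess, hαB 0 hαl.bot_lt, consTwo_zero]
      simp
    have hbranch : ∃ e, IsBranch 𝔅 α e := by
      obtain ⟨v, hv⟩ := (countable_Iio_of_lt hακ).exists_eq_range ⟨0, hαl.bot_lt⟩
      have hvα : ∀ n, v n < α := fun n => by
        have : v n ∈ Iio α := hv ▸ mem_range_self n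
        exact this
      -- The root guesses `{0}`: this is nonempty, so the root is a node, but `0` is not a limit, so
      -- it has no predecessor. Passing every `v n` makes the branch cofinal.
      let e : ℕ → Ordinal.{u} := fun n => Nat.rec (G (v 0) 0) (fun n x => G (v (n + 1)) x) n
      have he0 : e 0 = G (v 0) 0 := rfl
      have heS : ∀ n, e (n + 1) = G (v (n + 1)) (e n) := fun n => rfl
      have heα : ∀ n, e n < α := by
        intro n
        induction n with
        | zero => exact hαG _ (hvα 0) _ hαl.bot_lt
        | succ n ih => exact hαG _ (hvα _) _ ih
      have hform : ∀ n, ∃ x < α, e n = G (v n) x := by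
        intro n
        cases n with
        | zero => exact ⟨0, hαl.bot_lt, rfl⟩
        | succ n => exact ⟨e n, heα n, rfl⟩
      have hE : ∀ n, e n ∈ E ∧ v n < e n ∧ (∃ x, x < e n ∧ e n = G (v n) x ∧
          ∀ i < e n, 𝔅 (e n) i ∩ Iio (e n) = consTwo {x} E B i ∩ Iio (e n)) := by
        intro n
        obtain ⟨x, hx, hex⟩ := hform n
        have := hG (v n) x ((hvα n).trans hακ) (hx.trans hακ)
        rw [← hex] at this
        exact ⟨this.1, this.2.1, x, this.2.2.1, hex, this.2.2.2⟩
      have hEl : ∀ n, Order.IsSuccLimit (e n) := fun n => (hE n).1.2.1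
      have hq : ∀ n x, (∀ i < e n, 𝔅 (e n) i ∩ Iio (e n) = consTwo {x} E B i ∩ Iio (e n)) →
          x < e n → 𝔅 (e n) 0 ∩ Iio (e n) = {x} := fun n x h hx => by
        rw [h 0 (hEl n).bot_lt, consTwo_zero, inter_eq_left, singleton_subset_iff]
        exact hx
      have hguess : ∀ n, HasGuess 𝔅 (e n) := fun n => by
        obtain ⟨x, hx, -, h⟩ := (hE n).2.2
        rw [HasGuess, hq n x h hx]
        exact singleton_nonempty x
      have h0 := hG (v 0) 0 ((hvα 0).trans hακ) (hαl.bot_lt.trans hακ)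
      rw [← he0] at h0
      have hS := fun n => hG (v (n + 1)) (e n) ((hvα _).trans hακ) ((heα n).trans hακ)
      simp only [← heS] at hS
      refine ⟨e, ?_, fun n => ?_, hguess, hEl, heα, fun x hx => ?_, fun n => ?_, fun n i hi => ?_⟩
      · rw [predGuess, hq 0 0 h0.2.2.2 h0.2.2.1, csInf_singleton, if_neg]
        exact fun h => Ordinal.not_isSuccLimit_zero h.1
      · rw [predGuess, hq (n + 1) (e n) (hS n).2.2.2 (hS n).2.2.1, csInf_singleton, if_pos]
        exact ⟨hEl n, hguess n, (hS n).2.2.1⟩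
      · have : x ∈ range v := hv ▸ hx
        obtain ⟨n, rfl⟩ := this
        exact ⟨n, (hE n).2.1⟩
      · have h1 := hαB 1 hα1
        rw [consTwo_one] at h1
        exact (h1.ge ⟨(hE n).1, heα n⟩).1
      · obtain ⟨x, hx, -, h⟩ := (hE n).2.2
        have h1 := h _ (two_add_lt (hEl n) hi)
        have h2 := hαB _ (two_add_lt hαl (hi.trans (heα n)))
        rw [consTwo_two_add] at h1 h2
        rw [h1, ← inter_eq_right.2 (Iio_subset_Iio (heα n).le), ← inter_assoc, ← inter_assoc, h2]
    -- The branch selected by `branchSet` need not be the one just built. The clauses `mem` and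
    -- `agree` make every branch below `α` suitable, because `α` guesses `E` and `B` correctly.
    obtain ⟨e, he, hT⟩ := branchSet_of_exists hα0 hbranch
    refine ⟨α, hαS, hακ, hαl, ⟨hαl.bot_lt, fun x hx => ?_⟩, ?_, fun ε hε => ?_⟩
    · obtain ⟨n, hn⟩ := he.cofinal x hx
      exact ⟨e n, hT ▸ mem_range_self n, hn, he.lt n⟩
    · rw [hT, otp_range_of_strictMono he.strictMono, Cardinal.ord_aleph0, Ordinal.lift_omega0]
    · rw [hT] at hε
      obtain ⟨n, rfl⟩ := hε
      constructor
      · have h1 := hαB 1 hα1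
        rw [consTwo_one] at h1
        exact (h1.le ⟨he.mem n, he.lt n⟩).1
      · intro i hi
        have h2 := hαB _ (two_add_lt hαl (hi.trans (he.lt n)))
        rw [consTwo_two_add] at h2
        change 𝔅 (e n) (2 + i) ∩ Iio (e n) = _
        rw [he.agree n i hi, ← inter_eq_right.2 (Iio_subset_Iio (he.lt n).le), ← inter_assoc,
          ← inter_assoc, h2]

/-! ### Threads of type `ω` and a bound on order types. -/

/-- `F` is a cofinal subset of `α` of order type `ω` that lies in `A` above `π`, and whose elements
are separated from each other, and from `π`, by elements of `D`. -/
structure IsThread (A D : Set Ordinal.{u}) (π α : Ordinal.{u}) (F : Set Ordinal.{u}) : Prop where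
  subset : F ⊆ A
  lt : ∀ y ∈ F, y < α
  isLimPt : IsLimPt F α
  finite : ∀ x < α, (F ∩ Iio x).Finite
  sep_base : ∀ y ∈ F, ∃ η ∈ D, π < η ∧ η < y
  sep : ∀ x ∈ F, ∀ y ∈ F, x < y → ∃ η ∈ D, x < η ∧ η < y

theorem IsThread.base_lt {A D F : Set Ordinal.{u}} {π α y : Ordinal.{u}}
    (h : IsThread A D π α F) (hy : y ∈ F) : π < y := by
  obtain ⟨η, -, h1, h2⟩ := h.sep_base y hy
  exact h1.trans h2

theorem IsThread.mono {A A' D D' F : Set Ordinal.{u}} {π α : Ordinal.{u}}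
    (h : IsThread A D π α F) (hA : A ∩ Iio α ⊆ A') (hD : D ∩ Iio α ⊆ D') :
    IsThread A' D' π α F where
  subset x hx := hA ⟨h.subset hx, h.lt x hx⟩
  lt := h.lt
  isLimPt := h.isLimPt
  finite := h.finite
  sep_base y hy := let ⟨η, hη, h1, h2⟩ := h.sep_base y hy; ⟨η, hD ⟨hη, h2.trans (h.lt y hy)⟩, h1, h2⟩
  sep x hx y hy hxy := let ⟨η, hη, h1, h2⟩ := h.sep x hx y hy hxy
    ⟨η, hD ⟨hη, h2.trans (h.lt y hy)⟩, h1, h2⟩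

/-- Enumerate `G` in type `ω`. Each new element of the thread is taken in `A` beyond a point of `D`
that exceeds both the previous element and the next listed element of `G`. -/
theorem exists_isThread {A D G : Set Ordinal.{u}} {π α : Ordinal.{u}} (hG : G ⊆ Iio α)
    (hGc : G.Countable) (hGα : IsLimPt G α) (hA : IsLimPt A α) (hD : IsLimPt D α) (hπ : π < α) :
    ∃ F, IsThread A D π α F := by
  obtain ⟨v, rfl⟩ := hGc.exists_eq_range
    (let ⟨y, hy, _⟩ := hGα.2 0 hGα.1; ⟨y, hy⟩)
  have hv : ∀ n, v n < α := fun n => hG ⟨n, rfl⟩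
  have hnext : ∀ x, ∃ y, x < α → y ∈ A ∧ y < α ∧ ∃ η ∈ D, x < η ∧ η < y := by
    intro x
    by_cases hx : x < α
    · obtain ⟨η, hη, h1, h2⟩ := hD.2 x hx
      obtain ⟨y, hy, h3, h4⟩ := hA.2 η h2
      exact ⟨y, fun _ => ⟨hy, h4, η, hη, h1, h3⟩⟩
    · exact ⟨0, fun h => absurd h hx⟩
  choose N hN using hnext
  let e : ℕ → Ordinal.{u} := fun n => Nat.rec (N (max π (v 0))) (fun n x => N (max x (v (n + 1)))) n
  have heS : ∀ n, e (n + 1) = N (max (e n) (v (n + 1))) := fun n => rfl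
  have heα : ∀ n, e n < α := by
    intro n
    induction n with
    | zero => exact (hN _ (max_lt hπ (hv 0))).2.1
    | succ n ih => exact (hN _ (max_lt ih (hv _))).2.1
  have h0 := hN _ (max_lt hπ (hv 0))
  have hS := fun n => hN _ (max_lt (heα n) (hv (n + 1)))
  simp only [← heS] at hS
  have hmono : StrictMono e := strictMono_nat_of_lt_succ fun n => by
    obtain ⟨η, -, h1, h2⟩ := (hS n).2.2
    exact (le_max_left _ _).trans_lt (h1.trans h2)
  have hve : ∀ n, v n < e n := by
    intro n
    cases n with
    | zero =>
      obtain ⟨η, -, h1, h2⟩ := h0.2.2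
      exact (le_max_right _ _).trans_lt (h1.trans h2)
    | succ n =>
      obtain ⟨η, -, h1, h2⟩ := (hS n).2.2
      exact (le_max_right _ _).trans_lt (h1.trans h2)
  have hcof : ∀ x < α, ∃ n, x < e n := fun x hx => by
    obtain ⟨_, ⟨n, rfl⟩, h, -⟩ := hGα.2 x hx
    exact ⟨n, h.trans (hve n)⟩
  refine ⟨range e, ?_, ?_, ⟨hGα.1, fun x hx => ?_⟩, fun x hx => ?_, ?_, ?_⟩
  · rintro _ ⟨n, rfl⟩
    cases n with
    | zero => exact h0.1
    | succ n => exact (hS n).1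
  · rintro _ ⟨n, rfl⟩
    exact heα n
  · obtain ⟨n, hn⟩ := hcof x hx
    exact ⟨e n, ⟨n, rfl⟩, hn, heα n⟩
  · obtain ⟨n, hn⟩ := hcof x hx
    refine ((finite_Iio n).image e).subset ?_
    rintro _ ⟨⟨m, rfl⟩, hm⟩
    exact ⟨m, hmono.lt_iff_lt.1 (lt_trans hm hn), rfl⟩
  · rintro _ ⟨n, rfl⟩
    obtain ⟨η, hη, h1, h2⟩ := h0.2.2
    exact ⟨η, hη, (le_max_left _ _).trans_lt h1, h2.trans_le (hmono.monotone (Nat.zero_le n))⟩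
  · rintro _ ⟨m, rfl⟩ _ ⟨n, rfl⟩ hmn
    obtain ⟨η, hη, h1, h2⟩ := (hS m).2.2
    exact ⟨η, hη, (le_max_left _ _).trans_lt h1,
      h2.trans_le (hmono.monotone (hmono.lt_iff_lt.1 hmn))⟩

theorem isLimPt_univ {α : Ordinal.{u}} (hα : Order.IsSuccLimit α) : IsLimPt univ α :=
  ⟨hα.bot_lt, fun x hx => ⟨Order.succ x, mem_univ _, Order.lt_succ x, hα.succ_lt hx⟩⟩

/-- If the limit points of `C` below its elements lie in `T`, whose initial segments are short, then
`C` is at most `ω` times longer than these. -/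
theorem otp_le_omega_mul {C T : Set Ordinal.{u}} {μ : Ordinal.{u + 1}}
    (hfin : ∀ x ∈ C, {c | c ∈ C ∧ c < x ∧ ∀ t ∈ T, c < t → x < t}.Finite)
    (hT : ∀ x ∈ C, otp (T ∩ Iic x) < μ) : otp C ≤ ω * μ := by
  -- The rank of `x` counts the points of `T` up to `x` in units of `ω`, then the finitely many
  -- elements of `C` below `x` with no point of `T` in between.
  let r : C → Ordinal.{u + 1} := fun x => ω * otp (T ∩ Iic x.1) +
    ({c | c ∈ C ∧ c < x.1 ∧ ∀ t ∈ T, c < t → x.1 < t}.ncard : Ordinal.{u + 1})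
  have hr : StrictMono r := by
    intro x y hxy
    have hxy' : x.1 < y.1 := hxy
    by_cases h : ∃ t ∈ T, x.1 < t ∧ t ≤ y.1
    · obtain ⟨t, ht, h1, h2⟩ := h
      have hlt : otp (T ∩ Iic x.1) < otp (T ∩ Iic y.1) := by
        refine (otp_mono (D := T ∩ Iic y.1 ∩ Iio t) fun z hz => ⟨⟨hz.1, hz.2.trans hxy'.le⟩,
          lt_of_le_of_lt hz.2 h1⟩).trans_lt (otp_inter_Iio_lt ⟨ht, h2⟩)
      calc r x < ω * otp (T ∩ Iic x.1) + ω :=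
            (add_lt_add_iff_left _).2 (Ordinal.natCast_lt_omega0 _)
        _ = ω * (otp (T ∩ Iic x.1) + 1) := by rw [mul_add_one]
        _ ≤ ω * otp (T ∩ Iic y.1) := by gcongr; exact Order.add_one_le_of_lt hlt
        _ ≤ r y := le_self_add
    · push Not at h
      have heq : T ∩ Iic x.1 = T ∩ Iic y.1 := by
        ext t
        refine and_congr_right fun ht => ⟨fun h' => h'.trans hxy'.le, fun h' => ?_⟩
        by_contra! hlt
        exact absurd h' (not_le.2 (h t ht (not_le.1 hlt)))
      have : ({c | c ∈ C ∧ c < x.1 ∧ ∀ t ∈ T, c < t → x.1 < t}.ncard : Ordinal.{u + 1}) <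
          {c | c ∈ C ∧ c < y.1 ∧ ∀ t ∈ T, c < t → y.1 < t}.ncard := by
        refine Nat.cast_lt.2 (ncard_lt_ncard ⟨?_, fun hsub => ?_⟩ (hfin y y.2))
        · rintro c ⟨h1, h2, h3⟩
          exact ⟨h1, h2.trans hxy', fun t ht hct => h t ht (h3 t ht hct)⟩
        · exact lt_irrefl _ (hsub (show x.1 ∈ _ from ⟨x.2, hxy', fun t ht hct => h t ht hct⟩)).2.1
      simp only [r, heq]
      exact (add_lt_add_iff_left _).2 this
  have hlt : ∀ x, r x < ω * μ := fun x => by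
    calc r x < ω * otp (T ∩ Iic x.1) + ω :=
          (add_lt_add_iff_left _).2 (Ordinal.natCast_lt_omega0 _)
      _ = ω * (otp (T ∩ Iic x.1) + 1) := by rw [mul_add_one]
      _ ≤ ω * μ := by gcongr; exact Order.add_one_le_of_lt (hT x x.2)
  have h1 : StrictMono fun x : C => (Ordinal.ToType.mk ⟨r x, hlt x⟩ : (ω * μ).ToType) :=
    fun x y hxy => (OrderIso.lt_iff_lt _).2 (hr hxy)
  have h2 := Ordinal.type_le_iff'.2 ⟨(OrderEmbedding.ofStrictMono _ h1).ltEmbedding⟩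
  rwa [Ordinal.type_toType] at h2

/-! ### The clubs assembled from a ladder and its threads. -/

section Club

variable {lam : Cardinal.{u}} {S : Set Ordinal.{u}} {T F : Ordinal.{u} → Set Ordinal.{u}}
  {𝔅 : Ordinal.{u} → Ordinal.{u} → Set Ordinal.{u}} {α β ε x : Ordinal.{u}}

open Classical in
/-- The club of `α` that consists of the closed set `T α` and of the threads `F ε` that fill its
gaps. -/
noncomputable def threadClub (κ : Cardinal.{u}) (T F : Ordinal.{u} → Set Ordinal.{u})
    (α : Ordinal.{u}) : Set Ordinal.{u} :=
  if α < κ.ord ∧ Order.IsSuccLimit α then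
    T α ∪ {x | ∃ ε, (ε ∈ T α ∨ ε = α) ∧ ¬ IsLimPt (T ε) ε ∧ x ∈ F ε} else ∅

/-- Threads that fill the gaps of the ladder `T`. -/
def FillsGaps (lam : Cardinal.{u}) (T F : Ordinal.{u} → Set Ordinal.{u}) : Prop :=
  ∀ ε < (Order.succ lam).ord, Order.IsSuccLimit ε → ¬ IsLimPt (T ε) ε →
    IsThread univ univ (sSup (T ε)) ε (F ε)

theorem mem_threadClub (hα : α < (Order.succ lam).ord) (hl : Order.IsSuccLimit α) :
    x ∈ threadClub (Order.succ lam) T F α ↔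
      x ∈ T α ∨ ∃ ε, (ε ∈ T α ∨ ε = α) ∧ ¬ IsLimPt (T ε) ε ∧ x ∈ F ε := by
  rw [threadClub, if_pos ⟨hα, hl⟩]
  exact Iff.rfl

theorem Ladder.lt_and_isSuccLimit (hL : Ladder lam S T 𝔅) (hα : α < (Order.succ lam).ord)
    (hl : Order.IsSuccLimit α) (hε : ε ∈ T α ∨ ε = α) :
    ε ≤ α ∧ ε < (Order.succ lam).ord ∧ Order.IsSuccLimit ε := by
  rcases hε with hε | rfl
  · exact ⟨(hL.lt α hα hl ε hε).le, (hL.lt α hα hl ε hε).trans hα, hL.isSuccLimit α hα hl ε hε⟩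
  · exact ⟨le_rfl, hα, hl⟩

theorem Ladder.le_sSup (hL : Ladder lam S T 𝔅) (hα : α < (Order.succ lam).ord)
    (hl : Order.IsSuccLimit α) (hε : ε ∈ T α) : ε ≤ sSup (T α) :=
  le_csSup ⟨α, fun x hx => (hL.lt α hα hl x hx).le⟩ hε

theorem Ladder.coherent' (hL : Ladder lam S T 𝔅) (hα : α < (Order.succ lam).ord)
    (hl : Order.IsSuccLimit α) (hε : ε ∈ T α ∨ ε = α) : T ε = T α ∩ Iio ε := by
  rcases hε with hε | rfl
  · exact hL.coherent α hα hl ε hε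
  · exact (inter_eq_left.2 (hL.lt ε hα hl)).symm

/-- An element of the thread at `ε` lies between `ε` and the part of the ladder below `ε`. -/
theorem Ladder.lt_of_mem_thread (hL : Ladder lam S T 𝔅) (hF : FillsGaps lam T F)
    (hα : α < (Order.succ lam).ord) (hl : Order.IsSuccLimit α) (hε : ε ∈ T α ∨ ε = α)
    (hgap : ¬ IsLimPt (T ε) ε) (hx : x ∈ F ε) (hβ : β ∈ T α) : β < ε ↔ β < x := by
  obtain ⟨h1, h2, h3⟩ := hL.lt_and_isSuccLimit hα hl hε
  have hth := hF ε h2 h3 hgap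
  refine ⟨fun h => (hL.le_sSup h2 h3 ?_).trans_lt (hth.base_lt hx), fun h => h.trans (hth.lt x hx)⟩
  rw [hL.coherent' hα hl hε]
  exact ⟨hβ, h⟩

theorem Ladder.threadClub_lt (hL : Ladder lam S T 𝔅) (hF : FillsGaps lam T F)
    (hα : α < (Order.succ lam).ord) (hl : Order.IsSuccLimit α)
    (hx : x ∈ threadClub (Order.succ lam) T F α) : 0 < x ∧ x < α := by
  rcases (mem_threadClub hα hl).1 hx with hx | ⟨ε, hε, hgap, hx⟩
  · exact ⟨(hL.isSuccLimit α hα hl x hx).bot_lt, hL.lt α hα hl x hx⟩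
  · obtain ⟨h1, h2, h3⟩ := hL.lt_and_isSuccLimit hα hl hε
    have hth := hF ε h2 h3 hgap
    exact ⟨zero_le.trans_lt (hth.base_lt hx), (hth.lt x hx).trans_le h1⟩

/-- A thread at `ε' > ε` starts above `sup (T ε') ≥ ε`, so the part of the club below `ε ∈ T α` uses
only threads at points up to `ε`. -/
theorem Ladder.threadClub_coherent (hL : Ladder lam S T 𝔅) (hF : FillsGaps lam T F)
    (hα : α < (Order.succ lam).ord) (hl : Order.IsSuccLimit α) (hε : ε ∈ T α ∨ ε = α) :
    threadClub (Order.succ lam) T F ε = threadClub (Order.succ lam) T F α ∩ Iio ε := by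
  obtain ⟨h1, h2, h3⟩ := hL.lt_and_isSuccLimit hα hl hε
  have hcoh := hL.coherent' hα hl hε
  ext x
  constructor
  · intro hx
    refine ⟨?_, (hL.threadClub_lt hF h2 h3 hx).2⟩
    rw [mem_threadClub h2 h3, hcoh] at hx
    rw [mem_threadClub hα hl]
    rcases hx with hx | ⟨ε', hε', hgap, hx⟩
    · exact Or.inl hx.1
    · refine Or.inr ⟨ε', ?_, hgap, hx⟩
      rcases hε' with hε' | rfl
      · exact Or.inl hε'.1
      · exact hε
  · rintro ⟨hx, hxε⟩
    rw [mem_threadClub hα hl] at hx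
    rw [mem_threadClub h2 h3, hcoh]
    rcases hx with hx | ⟨ε', hε', hgap, hx⟩
    · exact Or.inl ⟨hx, hxε⟩
    · refine Or.inr ⟨ε', ?_, hgap, hx⟩
      have hle : ε' ≤ ε := by
        rcases hε with hε | rfl
        · by_contra! hlt
          exact lt_asymm hxε ((hL.lt_of_mem_thread hF hα hl hε' hgap hx hε).1 hlt)
        · exact (hL.lt_and_isSuccLimit hα hl hε').1
      rcases hle.lt_or_eq with hlt | rfl
      · rcases hε' with hε' | rfl
        · exact Or.inl ⟨hε', hlt⟩
        · exact absurd h1 (not_le.2 hlt)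
      · exact Or.inr rfl

theorem Ladder.isLimPt_threadClub_self (_ : Ladder lam S T 𝔅) (hF : FillsGaps lam T F)
    (hα : α < (Order.succ lam).ord) (hl : Order.IsSuccLimit α) :
    IsLimPt (threadClub (Order.succ lam) T F α) α := by
  by_cases h : IsLimPt (T α) α
  · exact h.mono fun x hx _ => (mem_threadClub hα hl).2 (Or.inl hx)
  · exact (hF α hα hl h).isLimPt.mono fun x hx _ =>
      (mem_threadClub hα hl).2 (Or.inr ⟨α, Or.inr rfl, h, hx⟩)

/-- Let `ε` be the least point of `T α ∪ {α}` with `ε ≥ β`. If `β < ε`, closedness bounds `T ε`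
strictly below `β`, so just below `β` the club consists of elements of `F ε`, finitely many in all.
Conversely, the club at a point of `T α` is cofinal in it and coheres. -/
theorem Ladder.isLimPt_threadClub_iff (hL : Ladder lam S T 𝔅) (hF : FillsGaps lam T F)
    (hα : α < (Order.succ lam).ord) (hl : Order.IsSuccLimit α) (hβ : β < α) :
    IsLimPt (threadClub (Order.succ lam) T F α) β ↔ β ∈ T α := by
  constructor
  · intro hlim
    let ε := sInf {ε | (ε ∈ T α ∨ ε = α) ∧ β ≤ ε}
    obtain ⟨hε, hβε⟩ : (ε ∈ T α ∨ ε = α) ∧ β ≤ ε :=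
      csInf_mem (s := {ε | (ε ∈ T α ∨ ε = α) ∧ β ≤ ε}) ⟨α, Or.inr rfl, hβ.le⟩
    have hmin : ∀ t ∈ T α, t < ε → t < β := fun t ht htε => by
      by_contra! hle
      exact absurd (csInf_le' (s := {ε | (ε ∈ T α ∨ ε = α) ∧ β ≤ ε}) ⟨Or.inl ht, hle⟩)
        (not_le.2 htε)
    rcases hβε.eq_or_lt with heq | hβε
    · rw [← heq] at hε
      exact hε.resolve_right hβ.ne
    exfalso
    obtain ⟨h1, h2, h3⟩ := hL.lt_and_isSuccLimit hα hl hε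
    have hcoh := hL.coherent' hα hl hε
    have hnl : ¬ IsLimPt (T ε) β := fun h => by
      have := hL.closed ε h2 h3 β hβε h
      rw [hcoh] at this
      exact lt_irrefl _ (hmin β this.1 this.2)
    obtain ⟨y, hy, hyT⟩ : ∃ y < β, ∀ t ∈ T ε, t ≤ y := by
      by_contra! hcon
      refine hnl ⟨hlim.1, fun y hy => ?_⟩
      obtain ⟨t, ht, hyt⟩ := hcon y hy
      rw [hcoh] at ht
      exact ⟨t, hcoh ▸ ht, hyt, hmin t ht.1 ht.2⟩
    have hgap : ¬ IsLimPt (T ε) ε := fun h => by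
      obtain ⟨t, ht, hyt, -⟩ := h.2 y (hy.trans hβε)
      exact absurd (hyT t ht) (not_le.2 hyt)
    have hFl : IsLimPt (F ε) β := by
      refine ⟨hlim.1, fun z hz => ?_⟩
      obtain ⟨c, hc, hzc, hcβ⟩ := hlim.2 (max y z) (max_lt hy hz)
      refine ⟨c, ?_, (le_max_right _ _).trans_lt hzc, hcβ⟩
      have hyc := (le_max_left y z).trans_lt hzc
      have hc' : c ∈ threadClub (Order.succ lam) T F ε := by
        rw [hL.threadClub_coherent hF hα hl hε]
        exact ⟨hc, hcβ.trans hβε⟩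
      rcases (mem_threadClub h2 h3).1 hc' with hc' | ⟨ε', hε' | rfl, hgap', hc'⟩
      · exact absurd (hyT c hc') (not_le.2 hyc)
      · obtain ⟨-, h5, h6⟩ := hL.lt_and_isSuccLimit h2 h3 (Or.inl hε')
        exact absurd (hyT ε' hε') (not_le.2 (hyc.trans ((hF ε' h5 h6 hgap').lt c hc')))
      · exact hc'
    exact hFl.infinite ((hF ε h2 h3 hgap).finite β hβε)
  · intro h
    obtain ⟨h1, h2, h3⟩ := hL.lt_and_isSuccLimit hα hl (Or.inl h)
    have := hL.isLimPt_threadClub_self hF h2 h3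
    rw [hL.threadClub_coherent hF hα hl (Or.inl h)] at this
    exact this.mono fun x hx _ => hx.1

theorem Ladder.acc_threadClub (hL : Ladder lam S T 𝔅) (hF : FillsGaps lam T F)
    (hα : α < (Order.succ lam).ord) (hl : Order.IsSuccLimit α) :
    acc (threadClub (Order.succ lam) T F α) = T α := by
  ext β
  rw [mem_acc_iff (hL.isLimPt_threadClub_self hF hα hl) fun x hx =>
    (hL.threadClub_lt hF hα hl hx).2]
  constructor
  · rintro ⟨h1, h2⟩
    exact (hL.isLimPt_threadClub_iff hF hα hl (hL.threadClub_lt hF hα hl h1).2).1 h2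
  · intro h
    exact ⟨(mem_threadClub hα hl).2 (Or.inl h),
      (hL.isLimPt_threadClub_iff hF hα hl (hL.lt α hα hl β h)).2 h⟩

theorem Ladder.isClubIn_threadClub (hL : Ladder lam S T 𝔅) (hF : FillsGaps lam T F)
    (hα : α < (Order.succ lam).ord) (hl : Order.IsSuccLimit α) :
    IsClubIn (threadClub (Order.succ lam) T F α) α :=
  (isClubIn_iff hl).2 ⟨fun _ hx => (hL.threadClub_lt hF hα hl hx).2,
    hL.isLimPt_threadClub_self hF hα hl, fun _ hβ h =>
    (mem_threadClub hα hl).2 (Or.inl ((hL.isLimPt_threadClub_iff hF hα hl hβ).1 h))⟩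

theorem Ladder.mk_inter_Iic_lt (hL : Ladder lam S T 𝔅)
    (hα : α < (Order.succ lam).ord) (hl : Order.IsSuccLimit α) (hx : x < α) :
    #(T α ∩ Iic x : Set Ordinal.{u}) < Cardinal.lift.{u + 1} lam := by
  by_cases h : ∃ t ∈ T α, x < t
  · obtain ⟨t, ht, hxt⟩ := h
    refine (Cardinal.mk_le_mk_of_subset fun y hy => ?_).trans_lt (hL.card_lt α hα hl t ht)
    rw [hL.coherent α hα hl t ht]
    exact ⟨hy.1, lt_of_le_of_lt hy.2 hxt⟩
  · refine (Cardinal.mk_le_mk_of_subset inter_subset_left).trans_lt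
      (hL.bounded α hα hl fun hlim => h ?_).1
    obtain ⟨t, ht, hxt, -⟩ := hlim.2 x hx
    exact ⟨t, ht, hxt⟩

theorem Ladder.otp_threadClub_le (hL : Ladder lam S T 𝔅) (hF : FillsGaps lam T F)
    (hα : α < (Order.succ lam).ord) (hl : Order.IsSuccLimit α) :
    otp (threadClub (Order.succ lam) T F α) ≤ Ordinal.lift.{u + 1} (ω * lam.ord) := by
  rw [Ordinal.lift_mul, Ordinal.lift_omega0]
  refine otp_le_omega_mul (T := T α) (fun x hx => ?_) fun x hx => ?_
  · by_contra hinf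
    obtain ⟨b, hb, hbl⟩ := exists_isLimPt_of_infinite hinf (y := x) fun c hc => hc.2.1
    have hxα := (hL.threadClub_lt hF hα hl hx).2
    have hbT := (hL.isLimPt_threadClub_iff hF hα hl (hb.trans_lt hxα)).1
      (hbl.mono fun c hc _ => hc.1)
    obtain ⟨c, hc, -, hcb⟩ := hbl.2 0 hbl.1
    exact absurd hb (not_le.2 (hc.2.2 b hbT hcb))
  · rw [Cardinal.lift_ord, Cardinal.lt_ord, card_otp]
    exact hL.mk_inter_Iic_lt hα hl (hL.threadClub_lt hF hα hl hx).2

theorem exists_mem_thread (hα : α < (Order.succ lam).ord)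
    (hl : Order.IsSuccLimit α) (hlim : IsLimPt (T α) α)
    (hx : x ∈ threadClub (Order.succ lam) T F α) (hxT : x ∉ T α) :
    ∃ ε ∈ T α, ¬ IsLimPt (T ε) ε ∧ x ∈ F ε := by
  obtain ⟨ε, hε | rfl, h⟩ := ((mem_threadClub hα hl).1 hx).resolve_left hxT
  · exact ⟨ε, hε, h⟩
  · exact absurd hlim h.1

end Club

/-! ### Labels and the capturing of sets at many accumulation points. -/

theorem exists_isMax_of_otp_eq_add_one {E : Set Ordinal.{u}} {o : Ordinal.{u + 1}}
    (h : otp E = o + 1) : ∃ x ∈ E, ∀ y ∈ E, y ≤ x := by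
  obtain ⟨x, hx⟩ := Ordinal.type_lt_mem_range_succ_iff.1 (⟨o, h.symm⟩ : otp E ∈ range Order.succ)
  exact ⟨x, x.2, fun y hy => not_lt.1 fun hlt => absurd (hx (b := ⟨y, hy⟩) hlt.le) (not_le.2 hlt)⟩

section Guess

variable {lam : Cardinal.{u}} {S : Set Ordinal.{u}} {T F : Ordinal.{u} → Set Ordinal.{u}}
  {𝔅 : Ordinal.{u} → Ordinal.{u} → Set Ordinal.{u}} {α β ε x : Ordinal.{u}}

theorem Ladder.otp_lt_iff (hL : Ladder lam S T 𝔅) (hα : α < (Order.succ lam).ord)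
    (hl : Order.IsSuccLimit α) (hβ : β ∈ T α) (hε : ε ∈ T α) :
    otp (T β) < otp (T ε) ↔ β < ε := by
  rw [hL.coherent α hα hl β hβ, hL.coherent α hα hl ε hε, otp_inter_Iio_lt_iff hβ hε]

theorem Ladder.exists_otp_eq (hL : Ladder lam S T 𝔅) (hα : α < (Order.succ lam).ord)
    (hl : Order.IsSuccLimit α) {o : Ordinal.{u + 1}} (ho : o < otp (T α)) :
    ∃ ε ∈ T α, otp (T ε) = o := by
  obtain ⟨ε, hε, h⟩ := exists_otp_inter_Iio_eq ho
  exact ⟨ε, hε, by rw [hL.coherent α hα hl ε hε, h]⟩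

theorem Ladder.otp_lt_otp (hL : Ladder lam S T 𝔅) (hα : α < (Order.succ lam).ord)
    (hl : Order.IsSuccLimit α) (hε : ε ∈ T α) : otp (T ε) < otp (T α) := by
  rw [hL.coherent α hα hl ε hε]
  exact otp_inter_Iio_lt hε

/-- Between the elements of index `i` and `i + j` of the ladder, `threadClub` has order type at
least `ω * j`. -/
theorem Ladder.omega_mul_le_otp (hL : Ladder lam S T 𝔅) (hF : FillsGaps lam T F)
    (hα : α < (Order.succ lam).ord) (hl : Order.IsSuccLimit α) (hβ : β ∈ T α)
    (j : Ordinal.{u + 1}) (hε : ε ∈ T α) (hj : otp (T ε) = otp (T β) + j) :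
    ω * j ≤ otp (threadClub (Order.succ lam) T F α \ Iio β ∩ Iio ε) := by
  induction j using WellFoundedLT.induction generalizing ε with
  | ind j ih =>
    refine le_of_forall_lt fun y hy => ?_
    obtain ⟨q, hq, r, hr, rfl⟩ := Ordinal.lt_mul_iff.1 hy
    obtain ⟨n, rfl⟩ := Ordinal.lt_omega0.1 hr
    have hlt : otp (T β) + q < otp (T ε) := by
      rw [hj]
      exact (add_lt_add_iff_left _).2 hq
    obtain ⟨ε', hε', hq'⟩ := hL.exists_otp_eq hα hl (hlt.trans (hL.otp_lt_otp hα hl hε))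
    rw [← hq', hL.otp_lt_iff hα hl hε' hε] at hlt
    have hβε' : β ≤ ε' := by
      rw [← not_lt, ← hL.otp_lt_iff hα hl hε' hβ, hq', not_lt]
      exact le_self_add
    have hmem : ∀ t ∈ T α, β ≤ t → t ∈ threadClub (Order.succ lam) T F α \ Iio β :=
      fun t ht h => ⟨(mem_threadClub hα hl).2 (Or.inl ht), not_lt.2 h⟩
    -- Start at the ladder point `ε'` of relative index `q` and take `n` further steps in the club;
    -- these stay below `ε` because `ε` is a limit point of the club.
    have key : ∀ n : ℕ, ∃ c ∈ threadClub (Order.succ lam) T F α \ Iio β, c < ε ∧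
        ω * q + n ≤ otp (threadClub (Order.succ lam) T F α \ Iio β ∩ Iio c) := by
      intro n
      induction n with
      | zero =>
        refine ⟨ε', hmem ε' hε' hβε', hlt, ?_⟩
        simpa using ih q hq hε' hq'
      | succ n ihn =>
        obtain ⟨c, hc, hcε, hle⟩ := ihn
        obtain ⟨c', hc', h1, h2⟩ :=
          ((hL.isLimPt_threadClub_iff hF hα hl (hL.lt α hα hl ε hε)).2 hε).2 c hcε
        have hc'' : c' ∈ threadClub (Order.succ lam) T F α \ Iio β :=
          ⟨hc', fun h => hc.2 (h1.trans h)⟩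
        refine ⟨c', hc'', h2, ?_⟩
        rw [Nat.cast_succ, ← add_assoc]
        exact Order.add_one_le_of_lt (hle.trans_lt ((otp_inter_Iio_lt_iff hc hc'').2 h1))
    obtain ⟨c, hc, hcε, hle⟩ := key n
    exact hle.trans_lt ((otp_inter_Iio_lt_iff hc (hmem ε hε (hβε'.trans hlt.le))).2 hcε)

/-- A point of `suc σ` has an immediate predecessor in the club, so it lies on a thread and not on
the ladder. If that thread came after the ladder point of relative index `τ`, then at least `ω * τ ≥
σ` elements would precede that ladder point, too many. -/
theorem Ladder.exists_mem_thread_of_mem_suc (hL : Ladder lam S T 𝔅) (hF : FillsGaps lam T F)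
    (hα : α < (Order.succ lam).ord) (hl : Order.IsSuccLimit α) (hlim : IsLimPt (T α) α)
    (hβ : β ∈ T α) {σ : Ordinal.{u}} {τ : Ordinal.{u + 1}}
    (hσ : Ordinal.lift.{u + 1} σ ≤ ω * τ) (hτ : otp (T β) + τ < otp (T α))
    (hx : x ∈ suc σ (threadClub (Order.succ lam) T F α \ Iio β)) :
    ∃ ε ∈ T α, ¬ IsLimPt (T ε) ε ∧ x ∈ F ε ∧ otp (T β) < otp (T ε) ∧
      otp (T ε) ≤ otp (T β) + τ := by
  obtain ⟨⟨hxC, hβx⟩, j, hj, hotp⟩ := hx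
  rw [mem_Iio, not_lt] at hβx
  rw [Ordinal.lift_add, Ordinal.lift_one] at hotp
  have hxT : x ∉ T α := by
    intro hxT
    obtain ⟨m, ⟨⟨hm, hβm⟩, hmx⟩, hmax⟩ := exists_isMax_of_otp_eq_add_one hotp
    obtain ⟨y, hy, h1, h2⟩ :=
      ((hL.isLimPt_threadClub_iff hF hα hl (hL.lt α hα hl x hxT)).2 hxT).2 m hmx
    exact absurd (hmax y ⟨⟨hy, fun h => hβm (h1.trans h)⟩, h2⟩) (not_le.2 h1)
  obtain ⟨ε, hε, hgap, hxε⟩ := exists_mem_thread hα hl hlim hxC hxT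
  obtain ⟨-, h2, h3⟩ := hL.lt_and_isSuccLimit hα hl (Or.inl hε)
  have hxlt := (hF ε h2 h3 hgap).lt x hxε
  refine ⟨ε, hε, hgap, hxε, (hL.otp_lt_iff hα hl hβ hε).2 (hβx.trans_lt hxlt), ?_⟩
  by_contra! hlt
  obtain ⟨ζ, hζ, hq⟩ := hL.exists_otp_eq hα hl hτ
  rw [← hq, hL.otp_lt_iff hα hl hζ hε, hL.lt_of_mem_thread hF hα hl (Or.inl hε) hgap hxε hζ]
    at hlt
  have hβζ : β ≤ ζ := by
    rw [← not_lt, ← hL.otp_lt_iff hα hl hζ hβ, hq, not_lt]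
    exact le_self_add
  have h4 := hL.omega_mul_le_otp hF hα hl hβ τ hζ hq
  have h5 := (otp_inter_Iio_lt_iff (D := threadClub (Order.succ lam) T F α \ Iio β)
    ⟨(mem_threadClub hα hl).2 (Or.inl hζ), not_lt.2 hβζ⟩ ⟨hxC, not_lt.2 hβx⟩).2 hlt
  rw [hotp] at h5
  have h6 : Ordinal.lift.{u + 1} j + 1 ≤ Ordinal.lift.{u + 1} σ :=
    Order.add_one_le_of_lt (Ordinal.lift_lt.2 hj)
  exact absurd (h5.trans_le (h6.trans hσ)) (not_lt.2 h4)

open Classical in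
/-- The index of the set from which the thread at `ε` is to be chosen: the element numbered `ξ`
(by `ψ`) of the `m`-th element of `T ε`, for the pair `(m, ξ)` that `g` assigns to the block of
length `τ` in which the index of `ε` lies. -/
noncomputable def label (T : Ordinal.{u} → Set Ordinal.{u})
    (g : Ordinal.{u + 1} → Ordinal.{u + 1} × Ordinal.{u + 1})
    (ψ : Ordinal.{u} → Ordinal.{u} → Ordinal.{u + 1}) (τ : Ordinal.{u + 1}) (ε : Ordinal.{u}) :
    Ordinal.{u} :=
  if h : ∃ δ, ∃ x ∈ T ε, δ < x ∧ (otp (T x), ψ x δ) = g (otp (T ε) / τ) then h.choose else 0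

variable {g : Ordinal.{u + 1} → Ordinal.{u + 1} × Ordinal.{u + 1}}
  {ψ : Ordinal.{u} → Ordinal.{u} → Ordinal.{u + 1}} {τ : Ordinal.{u + 1}}

theorem Ladder.label_lt (hL : Ladder lam S T 𝔅) (hε : ε < (Order.succ lam).ord)
    (hl : Order.IsSuccLimit ε) : label T g ψ τ ε < ε := by
  rw [label]
  split_ifs with h
  · obtain ⟨x, hx, hlt, -⟩ := h.choose_spec
    exact hlt.trans (hL.lt ε hε hl x hx)
  · exact hl.bot_lt

/-- The choice made in `label` is unique: indices are injective along `T ε`, and `ψ x` is injective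
on `x`. -/
theorem Ladder.label_eq (hL : Ladder lam S T 𝔅) (hε : ε < (Order.succ lam).ord)
    (hl : Order.IsSuccLimit ε)
    (hψ : ∀ x < (Order.succ lam).ord, ∀ δ < x, ∀ δ' < x, ψ x δ = ψ x δ' → δ = δ')
    {δ : Ordinal.{u}} (hx : x ∈ T ε) (hδ : δ < x)
    (hg : (otp (T x), ψ x δ) = g (otp (T ε) / τ)) : label T g ψ τ ε = δ := by
  have h : ∃ δ, ∃ x ∈ T ε, δ < x ∧ (otp (T x), ψ x δ) = g (otp (T ε) / τ) := ⟨δ, x, hx, hδ, hg⟩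
  rw [label, dif_pos h]
  obtain ⟨x', hx', hlt, heq⟩ := h.choose_spec
  replace heq := Prod.mk.inj (heq.trans hg.symm)
  have hxx : x' = x := by
    by_contra hne
    rcases lt_or_gt_of_ne hne with hlt | hlt
    · exact ((hL.otp_lt_iff hε hl hx' hx).2 hlt).ne heq.1
    · exact ((hL.otp_lt_iff hε hl hx hx').2 hlt).ne heq.1.symm
  subst hxx
  exact hψ x' ((hL.lt ε hε hl x' hx').trans hε) _ hlt _ hδ heq.2

/-- Ordinals `δ < x < λ⁺` are thereby named by ordinals below `λ`, so a bookkeeping of length `λ`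
can serve every `δ < α`. -/
theorem exists_enumeration (lam : Cardinal.{u}) :
    ∃ ψ : Ordinal.{u} → Ordinal.{u} → Ordinal.{u + 1}, ∀ x < (Order.succ lam).ord,
      (∀ δ < x, ψ x δ < (Cardinal.lift.{u + 1} lam).ord) ∧
      ∀ δ < x, ∀ δ' < x, ψ x δ = ψ x δ' → δ = δ' := by
  have : ∀ x, ∃ f : Ordinal.{u} → Ordinal.{u + 1}, x < (Order.succ lam).ord →
      (∀ δ < x, f δ < (Cardinal.lift.{u + 1} lam).ord) ∧
      ∀ δ < x, ∀ δ' < x, f δ = f δ' → δ = δ' := by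
    intro x
    by_cases hx : x < (Order.succ lam).ord
    · have hle : #(Iio x) ≤ #(Iio lam.ord) := by
        rw [Cardinal.mk_Iio_ordinal, Cardinal.mk_Iio_ordinal, Cardinal.card_ord, Cardinal.lift_le]
        exact Order.lt_succ_iff.1 (Cardinal.lt_ord.1 hx)
      obtain ⟨e⟩ := hle
      obtain ⟨f, hf⟩ : ∃ f : Ordinal.{u} → Ordinal.{u + 1},
          ∀ δ (h : δ ∈ Iio x), f δ = Ordinal.lift.{u + 1} (e ⟨δ, h⟩).1 := by
        classical
        exact ⟨fun δ => if h : δ ∈ Iio x then Ordinal.lift.{u + 1} (e ⟨δ, h⟩).1 else 0,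
          fun δ h => dif_pos h⟩
      refine ⟨f, fun _ => ⟨fun δ hδ => ?_, fun δ hδ δ' hδ' h => ?_⟩⟩
      · rw [hf δ hδ, ← Cardinal.lift_ord, Ordinal.lift_lt]
        exact (e _).2
      · rw [hf δ hδ, hf δ' hδ', Ordinal.lift_inj] at h
        exact congrArg Subtype.val (e.injective (Subtype.ext h))
    · exact ⟨fun _ => 0, fun h => absurd h hx⟩
  choose ψ hψ using this
  exact ⟨ψ, hψ⟩

/-- If every thread below `α` is chosen from the set prescribed by its label, then each set is
captured at `lam` many accumulation points of the club at `α`. -/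
theorem Ladder.le_mk_captured (hL : Ladder lam S T 𝔅) (hlam : ℵ₀ ≤ lam) (hF : FillsGaps lam T F)
    (hψ : ∀ x < (Order.succ lam).ord, (∀ δ < x, ψ x δ < (Cardinal.lift.{u + 1} lam).ord) ∧
      ∀ δ < x, ∀ δ' < x, ψ x δ = ψ x δ' → δ = δ')
    (hg : ∀ m < (Cardinal.lift.{u + 1} lam).ord, ∀ ξ < (Cardinal.lift.{u + 1} lam).ord,
      Cardinal.lift.{u + 2} (Cardinal.lift.{u + 1} lam) ≤
        #{b | m < b ∧ b < (Cardinal.lift.{u + 1} lam).ord ∧ g b = (m, ξ)})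
    {σ : Ordinal.{u}} (hσ : Ordinal.lift.{u + 1} σ ≤ ω * τ)
    (hτ : τ < (Cardinal.lift.{u + 1} lam).ord)
    (hα : α < (Order.succ lam).ord) (hl : Order.IsSuccLimit α) (hlim : IsLimPt (T α) α)
    (hotp : otp (T α) = (Cardinal.lift.{u + 1} lam).ord) {A : Ordinal.{u} → Set Ordinal.{u}}
    (hA : ∀ ε ∈ T α, ¬ IsLimPt (T ε) ε → F ε ⊆ A (label T g ψ (τ + 1) ε))
    {δ : Ordinal.{u}} (hδ : δ < α) :
    Cardinal.lift.{u + 1} lam ≤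
      #{β | β ∈ T α ∧ suc σ (threadClub (Order.succ lam) T F α \ Iio β) ⊆ A δ} := by
  have hlam' : ℵ₀ ≤ Cardinal.lift.{u + 1} lam := by simpa using hlam
  have hlimit := Cardinal.isSuccLimit_ord hlam'
  -- With block length `τ + 1`, all indices from `(τ + 1) * b` through `(τ + 1) * b + τ` have
  -- quotient `b`.
  have hτ' : τ + 1 < (Cardinal.lift.{u + 1} lam).ord := hlimit.add_one_lt hτ
  have hτ0 : 0 < τ + 1 := zero_lt_one.trans_le le_add_self
  obtain ⟨x, hx, hδx, -⟩ := hlim.2 δ hδ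
  have hxα := hL.lt α hα hl x hx
  have hm : otp (T x) < (Cardinal.lift.{u + 1} lam).ord := hotp ▸ hL.otp_lt_otp hα hl hx
  have hblock : ∀ b, otp (T x) < b → b < (Cardinal.lift.{u + 1} lam).ord →
      g b = (otp (T x), ψ x δ) → ∃ β, (β ∈ T α ∧
        suc σ (threadClub (Order.succ lam) T F α \ Iio β) ⊆ A δ) ∧
        otp (T β) = (τ + 1) * b := by
    intro b hmb hb hgb
    have hτb : (τ + 1) * b < (Cardinal.lift.{u + 1} lam).ord :=
      Ordinal.isPrincipal_mul_ord hlam' hτ' hb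
    have hτb' : (τ + 1) * b + τ < (Cardinal.lift.{u + 1} lam).ord :=
      Ordinal.isPrincipal_add_ord hlam' hτb hτ
    obtain ⟨β, hβ, hβb⟩ := hL.exists_otp_eq hα hl (hotp ▸ hτb)
    refine ⟨β, ⟨hβ, fun y hy => ?_⟩, hβb⟩
    obtain ⟨ε, hε, hgap, hyε, h1, h2⟩ := hL.exists_mem_thread_of_mem_suc hF hα hl hlim hβ hσ
      (by rw [hβb, hotp]; exact hτb') hy
    rw [hβb] at h1 h2
    have hdiv : otp (T ε) / (τ + 1) = b := by
      refine Ordinal.div_eq h1.le (h2.trans_lt ?_)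
      rw [mul_add_one]
      exact (add_lt_add_iff_left _).2 (lt_add_one τ)
    -- The index of `x` is below `b`, hence below the whole block: `T ε` already contains the point
    -- that the label refers to.
    have hxε : x ∈ T ε := by
      rw [hL.coherent α hα hl ε hε]
      refine ⟨hx, (hL.otp_lt_iff hα hl hx hε).1 (hmb.trans_le (le_trans ?_ h1.le))⟩
      exact Ordinal.le_mul_right b hτ0
    obtain ⟨-, h3, h4⟩ := hL.lt_and_isSuccLimit hα hl (Or.inl hε)
    have hlab : label T g ψ (τ + 1) ε = δ :=
      hL.label_eq h3 h4 (fun x hx => (hψ x hx).2) hxε hδx (by rw [hdiv, hgb])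
    have := hA ε hε hgap hyε
    rwa [hlab] at this
  choose f hf using hblock
  have hle := hg _ hm _ ((hψ x (hxα.trans hα)).1 δ hδx)
  have hinj := Cardinal.lift_mk_le_lift_mk_of_injective
    (α := {b | otp (T x) < b ∧ b < (Cardinal.lift.{u + 1} lam).ord ∧ g b = (otp (T x), ψ x δ)})
    (β := {β | β ∈ T α ∧ suc σ (threadClub (Order.succ lam) T F α \ Iio β) ⊆ A δ})
    (f := fun b => ⟨f b.1 b.2.1 b.2.2.1 b.2.2.2, (hf b.1 b.2.1 b.2.2.1 b.2.2.2).1⟩) (by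
      intro b b' h
      have h' : f b.1 b.2.1 b.2.2.1 b.2.2.2 = f b'.1 b'.2.1 b'.2.2.1 b'.2.2.2 :=
        congrArg Subtype.val h
      have h1 := (hf b.1 b.2.1 b.2.2.1 b.2.2.2).2
      rw [h', (hf b'.1 b'.2.1 b'.2.2.1 b'.2.2.2).2] at h1
      exact Subtype.ext (mul_left_cancel₀ hτ0.ne' h1).symm)
  have := (Cardinal.lift_le.{u + 1}.2 hle).trans hinj
  rw [← Cardinal.lift_le.{u + 2}]
  simpa using this

end Guess

/-! ### The coherent clubs, the function `h`, and the theorem. -/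

theorem isLimPt_congr {C D : Set Ordinal.{u}} {α : Ordinal.{u}} (h : C ∩ Iio α = D ∩ Iio α) :
    IsLimPt C α ↔ IsLimPt D α :=
  ⟨fun hC => hC.mono fun _ hx hxα => (h.le ⟨hx, hxα⟩).1,
    fun hD => hD.mono fun _ hx hxα => (h.ge ⟨hx, hxα⟩).1⟩

section Main

variable {lam : Cardinal.{u}} {S : Set Ordinal.{u}} {T F : Ordinal.{u} → Set Ordinal.{u}}
  {𝔅 : Ordinal.{u} → Ordinal.{u} → Set Ordinal.{u}} {α β ε x : Ordinal.{u}}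

/-- Threads chosen from the guessed sets prescribed by a labelling, whenever this is possible. -/
theorem Ladder.exists_threads (hL : Ladder lam S T 𝔅) (l : Ordinal.{u} → Ordinal.{u}) :
    ∃ F, FillsGaps lam T F ∧ ∀ ε < (Order.succ lam).ord, Order.IsSuccLimit ε →
      ¬ IsLimPt (T ε) ε → IsLimPt (𝔅 ε (2 + l ε)) ε → IsLimPt (𝔅 ε 0) ε →
      IsThread (𝔅 ε (2 + l ε)) (𝔅 ε 0) (sSup (T ε)) ε (F ε) := by
  have : ∀ ε, ∃ F, ε < (Order.succ lam).ord → Order.IsSuccLimit ε → ¬ IsLimPt (T ε) ε →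
      IsThread univ univ (sSup (T ε)) ε F ∧
      (IsLimPt (𝔅 ε (2 + l ε)) ε → IsLimPt (𝔅 ε 0) ε →
        IsThread (𝔅 ε (2 + l ε)) (𝔅 ε 0) (sSup (T ε)) ε F) := by
    intro ε
    by_cases h : ε < (Order.succ lam).ord ∧ Order.IsSuccLimit ε ∧ ¬ IsLimPt (T ε) ε
    · obtain ⟨hε, hl, hgap⟩ := h
      obtain ⟨-, G, hG, hGc, hGl⟩ := hL.bounded ε hε hl hgap
      have hsup : sSup (T ε) < ε := by
        refine lt_of_le_of_ne (csSup_le' fun x hx => (hL.lt ε hε hl x hx).le) fun heq => hgap ?_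
        rw [isLimPt_iff_sSup, inter_eq_left.2 (show T ε ⊆ Iio ε from hL.lt ε hε hl)]
        exact ⟨heq, hl.bot_lt⟩
      by_cases hlim : IsLimPt (𝔅 ε (2 + l ε)) ε ∧ IsLimPt (𝔅 ε 0) ε
      · obtain ⟨F, hF⟩ := exists_isThread hG hGc hGl hlim.1 hlim.2 hsup
        exact ⟨F, fun _ _ _ => ⟨hF.mono (subset_univ _) (subset_univ _), fun _ _ => hF⟩⟩
      · obtain ⟨F, hF⟩ := exists_isThread hG hGc hGl (isLimPt_univ hl) (isLimPt_univ hl) hsup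
        exact ⟨F, fun _ _ _ => ⟨hF, fun h1 h2 => absurd ⟨h1, h2⟩ hlim⟩⟩
    · exact ⟨∅, fun h1 h2 h3 => absurd ⟨h1, h2, h3⟩ h⟩
  choose F hF using this
  exact ⟨F, fun ε h1 h2 h3 => (hF ε h1 h2 h3).1, fun ε h1 h2 h3 => (hF ε h1 h2 h3).2⟩

open Classical in
/-- The value guessed at the least element of `T α` or, if `T α` is empty, at `α` itself. -/
noncomputable def guessedValue (T : Ordinal.{u} → Set Ordinal.{u})
    (𝔅 : Ordinal.{u} → Ordinal.{u} → Set Ordinal.{u}) (α : Ordinal.{u}) : Ordinal.{u} :=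
  if (T α).Nonempty then sInf (𝔅 (sInf (T α)) 1 ∩ Iio (sInf (T α))) else sInf (𝔅 α 1 ∩ Iio α)

theorem sInf_inter_Iio_le (A : Set Ordinal.{u}) (α : Ordinal.{u}) : sInf (A ∩ Iio α) ≤ α := by
  rcases (A ∩ Iio α).eq_empty_or_nonempty with h | ⟨x, hx⟩
  · rw [h, Ordinal.sInf_empty]
    exact zero_le
  · exact (csInf_le' hx).trans hx.2.le

theorem Ladder.guessedValue_le (hL : Ladder lam S T 𝔅) (hα : α < (Order.succ lam).ord)
    (hl : Order.IsSuccLimit α) : guessedValue T 𝔅 α ≤ α := by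
  rw [guessedValue]
  split_ifs with h
  · exact (sInf_inter_Iio_le _ _).trans (hL.lt α hα hl _ (csInf_mem h)).le
  · exact sInf_inter_Iio_le _ _

/-- Either `T ε` has the same minimum as `T α`, or `ε` is that minimum; then `T ε` is empty and the
value is read at `ε` itself. -/
theorem Ladder.guessedValue_eq (hL : Ladder lam S T 𝔅) (hα : α < (Order.succ lam).ord)
    (hl : Order.IsSuccLimit α) (hε : ε ∈ T α) : guessedValue T 𝔅 ε = guessedValue T 𝔅 α := by
  have hcoh := hL.coherent α hα hl ε hε
  have hne : (T α).Nonempty := ⟨ε, hε⟩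
  have hle : sInf (T α) ≤ ε := csInf_le' hε
  rcases hle.lt_or_eq with hlt | heq
  · have hmem : sInf (T α) ∈ T ε := hcoh ▸ ⟨csInf_mem hne, hlt⟩
    have hinf : sInf (T ε) = sInf (T α) :=
      le_antisymm (csInf_le' hmem) (le_csInf ⟨_, hmem⟩ fun x hx => csInf_le' (hcoh ▸ hx).1)
    rw [guessedValue, guessedValue, if_pos ⟨_, hmem⟩, if_pos hne, hinf]
  · have hemp : ¬ (T ε).Nonempty := by
      rintro ⟨x, hx⟩
      rw [hcoh] at hx
      exact absurd (csInf_le' hx.1) (not_le.2 (lt_of_lt_of_eq hx.2 heq.symm))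
    rw [guessedValue, guessedValue, if_neg hemp, if_pos hne, heq]

/-- If `γ` is on the ladder, it is a limit of `D`. If it is on the thread at `ε`, then `β` is either
on the same thread or at most `sup (T ε)`, and the thread is separated from that base. -/
theorem Ladder.exists_separated (hL : Ladder lam S T 𝔅) (hF : FillsGaps lam T F)
    (hα : α < (Order.succ lam).ord) (hl : Order.IsSuccLimit α) (hlim : IsLimPt (T α) α)
    {D : Set Ordinal.{u}} (hD : ∀ ε ∈ T α, IsLimPt D ε)
    (hthread : ∀ ε ∈ T α, ¬ IsLimPt (T ε) ε → IsThread univ D (sSup (T ε)) ε (F ε))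
    {γ : Ordinal.{u}} (hβ : β ∈ threadClub (Order.succ lam) T F α)
    (hγ : γ ∈ threadClub (Order.succ lam) T F α) (hβγ : β < γ) : ∃ η ∈ D, β < η ∧ η < γ := by
  by_cases hγT : γ ∈ T α
  · exact (hD γ hγT).2 β hβγ
  obtain ⟨ε, hε, hgap, hγε⟩ := exists_mem_thread hα hl hlim hγ hγT
  obtain ⟨h1, h2, h3⟩ := hL.lt_and_isSuccLimit hα hl (Or.inl hε)
  have hth := hthread ε hε hgap
  by_cases hβε : β ∈ F ε
  · exact hth.sep β hβε γ hγε hβγ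
  have hle : β ≤ sSup (T ε) := by
    have hβ' : β ∈ threadClub (Order.succ lam) T F ε := by
      rw [hL.threadClub_coherent hF hα hl (Or.inl hε)]
      exact ⟨hβ, hβγ.trans (hth.lt γ hγε)⟩
    rcases (mem_threadClub h2 h3).1 hβ' with hβ' | ⟨ε', hε' | rfl, hgap', hβ'⟩
    · exact hL.le_sSup h2 h3 hβ'
    · obtain ⟨-, h5, h6⟩ := hL.lt_and_isSuccLimit h2 h3 (Or.inl hε')
      exact ((hF ε' h5 h6 hgap').lt β hβ').le.trans (hL.le_sSup h2 h3 hε')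
    · exact absurd hβ' hβε
  obtain ⟨η, hη, h4, h5⟩ := hth.sep_base γ hγε
  exact ⟨η, hη, hle.trans_lt h4, h5⟩

/-- A ladder with a guessing sequence yields a coherent sequence of clubs of order type at most
`ω * lam` with strong hitting properties. -/
theorem Ladder.exists_coherent_clubs (hL : Ladder lam S T 𝔅) (hlam : ℵ₀ ≤ lam)
    {σ : Ordinal.{u}} (hσ : σ < ω * lam.ord) :
    ∃ (C : Ordinal.{u} → Set Ordinal.{u}) (h : Ordinal.{u} → Ordinal.{u}),
      (∀ α < (Order.succ lam).ord, h α < (Order.succ lam).ord) ∧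
      (∀ α, C α ⊆ Iio α) ∧
      (∀ α < (Order.succ lam).ord, otp (C α) ≤ Ordinal.lift.{u + 1} (ω * lam.ord)) ∧
      (∀ α < (Order.succ lam).ord, Order.IsSuccLimit α → IsClubIn (C α) α ∧ 0 ∉ C α) ∧
      (∀ α < (Order.succ lam).ord, ∀ α' ∈ acc (C α), C α' = C α ∩ Iio α' ∧ h α' = h α) ∧
      ∀ A : Ordinal.{u} → Set Ordinal.{u},
        (∀ δ < (Order.succ lam).ord, IsCofinalIn (A δ) (Order.succ lam).ord) →
        ∀ D : Set Ordinal.{u}, IsClubIn D (Order.succ lam).ord →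
        ∀ ς < (Order.succ lam).ord, ∃ α ∈ S, α < (Order.succ lam).ord ∧ α ∈ D ∧
          h α = ς ∧
          nacc (C α) ⊆ ⋃ δ < α, A δ ∧
          (∀ δ < α, otp {β | β ∈ acc (C α) ∧ suc σ (C α \ Iio β) ⊆ A δ} =
            Ordinal.lift.{u + 1} lam.ord) ∧
          (∀ δ < α, sSup {β | β ∈ C α ∧ suc σ (C α \ Iio β) ⊆ A δ} = α) ∧
          ∀ β ∈ C α, ∀ γ ∈ C α, β < γ → ∃ η ∈ D, β < η ∧ η < γ := by
  classical
  have hreg := Cardinal.isRegular_succ hlam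
  have hlimκ := Cardinal.isSuccLimit_ord hreg.aleph0_le
  have hlam' : ℵ₀ ≤ Cardinal.lift.{u + 1} lam := by simpa using hlam
  obtain ⟨g, hg⟩ := exists_bookkeeping hlam'
  obtain ⟨ψ, hψ⟩ := exists_enumeration lam
  -- Write `σ = ω * q + r` with `q < λ` and `r < ω`; then `τ = q + 1` works.
  obtain ⟨τ, hτ, hστ⟩ : ∃ τ < (Cardinal.lift.{u + 1} lam).ord,
      Ordinal.lift.{u + 1} σ ≤ ω * τ := by
    rw [← Ordinal.lift_lt.{u + 1}, Ordinal.lift_mul, Ordinal.lift_omega0, Cardinal.lift_ord] at hσ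
    obtain ⟨q, hq, r, hr, heq⟩ := Ordinal.lt_mul_iff.1 hσ
    refine ⟨q + 1, (Cardinal.isSuccLimit_ord hlam').add_one_lt hq, ?_⟩
    rw [heq, mul_add_one]
    exact (add_le_add_iff_left _).2 hr.le
  obtain ⟨F, hF, hFA⟩ := hL.exists_threads (label T g ψ (τ + 1))
  let C := threadClub (Order.succ lam) T F
  have hCne : ∀ α, ¬ (α < (Order.succ lam).ord ∧ Order.IsSuccLimit α) → C α = ∅ :=
    fun α h => if_neg h
  refine ⟨C, fun α => if Order.IsSuccLimit α then guessedValue T 𝔅 α else 0, ?_, ?_, ?_, ?_, ?_, ?_⟩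
  · intro α hα
    by_cases hl : Order.IsSuccLimit α
    · simpa only [hl, if_true] using (hL.guessedValue_le hα hl).trans_lt hα
    · simpa only [hl, if_false] using hreg.ord_pos
  · intro α x hx
    by_cases h : α < (Order.succ lam).ord ∧ Order.IsSuccLimit α
    · exact (hL.threadClub_lt hF h.1 h.2 hx).2
    · rw [hCne α h] at hx
      exact absurd hx (notMem_empty x)
  · intro α hα
    by_cases hl : Order.IsSuccLimit α
    · exact hL.otp_threadClub_le hF hα hl
    · rw [hCne α fun h => hl h.2, otp, Ordinal.type_eq_zero_of_empty]
      exact zero_le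
  · intro α hα hl
    exact ⟨hL.isClubIn_threadClub hF hα hl, fun h => (hL.threadClub_lt hF hα hl h).1.false⟩
  · intro α hα α' hα'
    by_cases hl : Order.IsSuccLimit α
    · rw [hL.acc_threadClub hF hα hl] at hα'
      refine ⟨hL.threadClub_coherent hF hα hl (Or.inl hα'), ?_⟩
      simp only [hl, hL.isSuccLimit α hα hl α' hα', if_true]
      exact hL.guessedValue_eq hα hl hα'
    · rw [hCne α fun h => hl h.2, acc_empty] at hα'
      exact absurd hα' (notMem_empty _)
  · intro A hA D hD ς hς
    obtain ⟨d, hd⟩ := hD.exists_next hlimκ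
    have hAl : ∀ δ < (Order.succ lam).ord, IsLimPt (A δ) (Order.succ lam).ord :=
      fun δ hδ => ((isCofinalIn_iff hlimκ).1 (hA δ hδ)).2
    have hnext : ∀ δ x, ∃ y, δ < (Order.succ lam).ord → x < (Order.succ lam).ord →
        y ∈ A δ ∧ x < y ∧ y < (Order.succ lam).ord := by
      intro δ x
      by_cases h : δ < (Order.succ lam).ord ∧ x < (Order.succ lam).ord
      · obtain ⟨y, hy⟩ := (hAl δ h.1).2 x h.2
        exact ⟨y, fun _ _ => hy⟩
      · exact ⟨0, fun h1 h2 => absurd ⟨h1, h2⟩ h⟩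
    choose a ha using hnext
    -- The two leading slots now carry `D` and `{ς}`. Closure under the next-element functions makes
    -- each `ε ∈ T α` a limit of `D` and of every `A δ` with `δ < ε`, and places it above `ς`.
    obtain ⟨α, hαS, hα, hl, hlim, hotp, hT⟩ := hL.guess (consTwo D {ς} A)
      (fun x y => max (a x y) (max (d y) ς)) fun x hx y hy =>
        max_lt (ha x y hx hy).2.2 (max_lt (hD.1 (hd y hy).2) hς)
    have hTf : ∀ ε ∈ T α, Order.IsSuccLimit ε ∧ (∀ δ < ε, IsLimPt (A δ) ε) ∧ IsLimPt D ε ∧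
        ς < ε ∧ ∀ i < ε, 𝔅 ε i ∩ Iio ε = consTwo D {ς} A i ∩ Iio ε := by
      intro ε hε
      obtain ⟨h1, h2⟩ := hT ε hε
      obtain ⟨h3, h4⟩ := mem_closurePts_max.1 h1
      obtain ⟨h5, h6⟩ := (mem_closurePts_max (f := fun _ y => d y) (g := fun _ _ => ς)).1 h4
      have hpos : 0 < ε := h3.2.1.bot_lt
      refine ⟨h3.2.1, fun δ hδ => ⟨hpos, fun x hx => ?_⟩, ⟨hpos, fun x hx => ?_⟩,
        h6.2.2 0 hpos 0 hpos, h2⟩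
      · have := ha δ x (hδ.trans h3.1) (hx.trans h3.1)
        exact ⟨a δ x, this.1, this.2.1, h3.2.2 δ hδ x hx⟩
      · have := hd x (hx.trans h3.1)
        exact ⟨d x, this.2, this.1, h5.2.2 x hx x hx⟩
    have hDcl := ((isClubIn_iff hlimκ).1 hD).2.2
    have hTD : ∀ ε ∈ T α, ε ∈ D := fun ε hε =>
      hDcl ε ((hL.lt α hα hl ε hε).trans hα) (hTf ε hε).2.2.1
    have hthread : ∀ ε ∈ T α, ¬ IsLimPt (T ε) ε →
        IsThread (A (label T g ψ (τ + 1) ε)) D (sSup (T ε)) ε (F ε) := by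
      intro ε hε hgap
      obtain ⟨-, h2, h3⟩ := hL.lt_and_isSuccLimit hα hl (Or.inl hε)
      obtain ⟨-, h4, h5, -, h6⟩ := hTf ε hε
      have hlab := hL.label_lt (g := g) (ψ := ψ) (τ := τ + 1) h2 h3
      have h7 := h6 0 h3.bot_lt
      have h8 := h6 _ (two_add_lt h3 hlab)
      rw [consTwo_zero] at h7
      rw [consTwo_two_add] at h8
      refine (hFA ε h2 h3 hgap ((isLimPt_congr h8).2 (h4 _ hlab)) ((isLimPt_congr h7).2 h5)).mono
        ?_ ?_
      · rw [h8]
        exact inter_subset_left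
      · rw [h7]
        exact inter_subset_left
    have hacc : acc (C α) = T α := hL.acc_threadClub hF hα hl
    have hmk : ∀ δ < α, Cardinal.lift.{u + 1} lam ≤
        #{β | β ∈ T α ∧ suc σ (C α \ Iio β) ⊆ A δ} := fun δ hδ =>
      hL.le_mk_captured hlam hF hψ hg hστ hτ hα hl hlim (by rw [hotp, Cardinal.lift_ord])
        (fun ε hε hgap => (hthread ε hε hgap).subset) hδ
    refine ⟨α, hαS, hα, hDcl α hα (hlim.mono fun x hx _ => hTD x hx), ?_, ?_, ?_, ?_, ?_⟩
    · simp only [hl, if_true]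
      have hne : (T α).Nonempty := let ⟨y, hy, _⟩ := hlim.2 0 hlim.1; ⟨y, hy⟩
      obtain ⟨h1, -, -, h2, h3⟩ := hTf _ (csInf_mem hne)
      have h4 := h3 1 (Ordinal.one_lt_of_isSuccLimit h1)
      rw [consTwo_one, inter_eq_left.2
        (show ({ς} : Set Ordinal.{u}) ⊆ Iio (sInf (T α)) from singleton_subset_iff.2 h2)] at h4
      rw [guessedValue, if_pos hne, h4, csInf_singleton]
    · intro x hx
      rw [mem_nacc_iff (hL.isLimPt_threadClub_self hF hα hl) fun x hx =>
        (hL.threadClub_lt hF hα hl hx).2] at hx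
      have hxα := (hL.threadClub_lt hF hα hl hx.1).2
      obtain ⟨ε, hε, hgap, hxε⟩ := exists_mem_thread hα hl hlim hx.1 fun h =>
        hx.2 ((hL.isLimPt_threadClub_iff hF hα hl hxα).2 h)
      obtain ⟨h1, h2, h3⟩ := hL.lt_and_isSuccLimit hα hl (Or.inl hε)
      exact mem_iUnion₂.2 ⟨_, (hL.label_lt h2 h3).trans_le h1, (hthread ε hε hgap).subset hxε⟩
    · intro δ hδ
      rw [hacc]
      refine le_antisymm ((otp_mono fun β hβ => hβ.1).trans hotp.le) ?_
      rw [Cardinal.lift_ord, Cardinal.ord_le, card_otp]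
      exact hmk δ hδ
    · intro δ hδ
      have hsub : {β | β ∈ C α ∧ suc σ (C α \ Iio β) ⊆ A δ} ⊆ Iio α :=
        fun β hβ => (hL.threadClub_lt hF hα hl hβ.1).2
      refine IsLimPt.sSup_eq ⟨hl.bot_lt, fun x hx => ?_⟩ hsub
      -- Otherwise `λ` many captured points would lie in a proper initial segment of `T α`, which
      -- has fewer than `λ` elements.
      by_contra! hcon
      have hbdd : {β | β ∈ T α ∧ suc σ (C α \ Iio β) ⊆ A δ} ⊆ T α ∩ Iic x := by
        refine fun β hβ => ⟨hβ.1, show β ≤ x from not_lt.1 fun hlt => ?_⟩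
        exact absurd (hL.lt α hα hl β hβ.1) (not_lt.2
          (hcon β ⟨(mem_threadClub hα hl).2 (Or.inl hβ.1), hβ.2⟩ hlt))
      exact absurd ((hmk δ hδ).trans (Cardinal.mk_le_mk_of_subset hbdd))
        (not_le.2 (hL.mk_inter_Iic_lt hα hl hx))
    · intro β hβ γ hγ hβγ
      exact hL.exists_separated hF hα hl hlim (fun ε hε => (hTf ε hε).2.2.1)
        (fun ε hε hgap => (hthread ε hε hgap).mono (subset_univ _) inter_subset_left) hβ hγ hβγ

theorem isSmallIn_of_subset_Iio {κ : Cardinal.{u}} {C : Set Ordinal.{u}} (hα : α < κ.ord)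
    (hC : C ⊆ Iio α) : IsSmallIn κ C := by
  refine ⟨hC.trans (Iio_subset_Iio hα.le), (Cardinal.mk_le_mk_of_subset hC).trans_lt ?_⟩
  rw [Cardinal.mk_Iio_ordinal, Cardinal.lift_lt]
  exact Cardinal.lt_ord.1 hα

end Main

end ProxyPrinciple

theorem mainTheorem4 (lam : Cardinal.{u}) (S : Set Ordinal.{u})
    (hS : (lam = ℵ₀ ∧ S ⊆ Iio (Order.succ lam).ord ∧ Diamond (Order.succ lam) S) ∨
      (ℵ₀ < lam ∧ S = cofSet (Order.succ lam) lam.ord.cof ∧ SquareDiamond lam))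
    (σ : Ordinal.{u}) (hσ : σ < ω * lam.ord) :
    Proxy (Order.succ lam) 2 (EndExt (Order.succ lam)) (Order.succ lam) {S} 2 σ
      (OtpLE (Order.succ lam) (ω * lam.ord)) ∧
    ∃ (C : Ordinal.{u} → Set Ordinal.{u}) (h : Ordinal.{u} → Ordinal.{u}),
      IsWitness (Order.succ lam) 2 (EndExt (Order.succ lam)) (Order.succ lam) {S} 2 σ
        (OtpLE (Order.succ lam) (ω * lam.ord)) (fun α => {C α}) ∧
      (∀ α < (Order.succ lam).ord, h α < (Order.succ lam).ord) ∧
      (∀ α < (Order.succ lam).ord, Order.IsSuccLimit α →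
        IsClubIn (C α) α ∧ 0 ∉ C α ∧ otp (C α) ≤ Ordinal.lift.{u + 1} (ω * lam.ord)) ∧
      (∀ α < (Order.succ lam).ord, ∀ α' ∈ acc (C α), C α' = C α ∩ Iio α' ∧ h α' = h α) ∧
      ∀ A : Ordinal.{u} → Set Ordinal.{u},
        (∀ δ < (Order.succ lam).ord, IsCofinalIn (A δ) (Order.succ lam).ord) →
        ∀ D : Set Ordinal.{u}, IsClubIn D (Order.succ lam).ord →
        ∀ ς < (Order.succ lam).ord, ∃ α ∈ S,
          h α = ς ∧
          nacc (C α) ⊆ ⋃ δ < α, A δ ∧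
          (∀ δ < α, otp {β | β ∈ acc (C α) ∧ suc σ (C α \ Iio β) ⊆ A δ} =
            Ordinal.lift.{u + 1} lam.ord) ∧
          ∀ β ∈ C α, ∀ γ ∈ C α, β < γ → ∃ η ∈ D, β < η ∧ η < γ := by
  have hlam : ℵ₀ ≤ lam := by
    rcases hS with ⟨rfl, -⟩ | ⟨h, -⟩
    · exact le_rfl
    · exact h.le
  have hSκ : S ⊆ Iio (Order.succ lam).ord := by
    rcases hS with ⟨-, h, -⟩ | ⟨-, rfl, -⟩
    · exact h
    · exact fun α hα => hα.1
  have hdiamond : Diamond (Order.succ lam) (Iio (Order.succ lam).ord) := by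
    rcases hS with ⟨-, h1, h2⟩ | ⟨h1, -, h2⟩
    · exact h2.mono h1 subset_rfl
    · exact h2.diamond h1
  obtain ⟨T, 𝔅, hL⟩ : ∃ T 𝔅, Ladder lam S T 𝔅 := by
    rcases hS with ⟨rfl, -, h⟩ | ⟨h1, rfl, h2⟩
    · exact h.exists_ladder
    · exact h2.exists_ladder h1
  obtain ⟨C, h, hh, hCα, hotp, hclub, hcoh, hguess⟩ := hL.exists_coherent_clubs hlam hσ
  have hw : IsWitness (Order.succ lam) 2 (EndExt (Order.succ lam)) (Order.succ lam) {S} 2 σ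
      (OtpLE (Order.succ lam) (ω * lam.ord)) (fun α => {C α}) := by
    refine ⟨?_, ?_, ?_, ?_, ?_⟩
    · rintro α hα hl _ rfl
      exact (hclub α hα hl).1
    · intro α hα
      simp
    · rintro α hα _ rfl _ rfl
      have := (hCα α).trans (Iio_subset_Iio hα.le)
      exact ⟨⟨this, hotp α hα⟩, this, hotp α hα⟩
    · rintro α hα _ rfl α' hα'
      have hlt := (hCα α hα'.1).trans hα
      exact ⟨C α', rfl, isSmallIn_of_subset_Iio hlt (hCα α'), isSmallIn_of_subset_Iio hα (hCα α),
        α', hlt, (hcoh α hα α' hα').1⟩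
    · rintro A hA _ rfl
      refine isStationaryIn_of_forall (fun α hα => hSκ hα.1) fun D hD => ?_
      -- Stationarity comes from the clause `α ∈ D`; the value of `h` plays no role here, so `0` is
      -- prescribed.
      obtain ⟨α, hαS, -, hαD, -, -, -, hsup, -⟩ := hguess A hA D hD 0
        (Cardinal.isRegular_succ hlam).ord_pos
      refine ⟨α, ⟨hαS, by simp, ?_⟩, hαD⟩
      rintro _ rfl i hi
      exact hsup i (lt_min_iff.1 hi).1
  refine ⟨⟨⟨_, hw⟩, hdiamond⟩, C, h, hw, hh, fun α hα hl =>
    ⟨(hclub α hα hl).1, (hclub α hα hl).2, hotp α hα⟩, hcoh, fun A hA D hD ς hς => ?_⟩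
  obtain ⟨α, hαS, -, -, h1, h2, h3, -, h4⟩ := hguess A hA D hD ς hς
  exact ⟨α, hαS, h1, h2, h3, h4⟩
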